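/- **Setting.** Let $d\ge 1$ and let $\mathcal A=\overline{\bigotimes_{\mathbb Z}M_d(\mathbb C)}^{C^*}$ be the UHF $C^*$-algebra of the quantum spin chain. For $j\in\mathbb Z$ let $Q^{(j)}\in\mathcal A$ denote the matrix $Q\in M_d(\mathbb C)$ placed at the site $j$. For $\Lambda\subset\mathbb Z$ let $\mathcal A_\Lambda$ be the $C^*$-subalgebra generated by the elements $Q^{(j)}$, $j\in\Lambda$, and let $\tau_k$ ($k\in\mathbb Z$) be the translation automorphism with $\tau_k(Q^{(j)})=Q^{(j+k)}$. A state $\varphi$ of $\mathcal A$ is *finitely correlated* if for every $k\in\mathbb Z$ the set of linear functionals $R\mapsto\varphi(QR)$ on $\mathcal A_{(-\infty,k]}$, where $Q$ runs over $\mathcal A_{[k+1,\infty)}$, is a finite-dimensional vector space. For $Q\in\mathcal A$ put $\|Q\|^{(0)}=\|Q\|$ and $\|Q\|^{(n)}=\inf\{\|Q-Q'\| : Q'\in\mathcal A_{[-n,n]}\}$ for $n\ge1$. For $0<\theta<1$ let $F_\theta$ be the set of all $Q\in\mathcal A$ with $\sum_{n\ge0}\|Q\|^{(n)}\theta^{-n}<\infty$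 (the exponentially localized elements; every strictly local $Q$ belongs to every $F_\theta$). Given a state $\varphi$, put $$Q_{\langle N\rangle}=\frac1{\sqrt{2N+1}}\sum_{|j|\le N}\bigl(\tau_j(Q)-\varphi(Q)1\bigr),\qquad t(Q,Q)=\lim_{N\to\infty}\varphi(Q_{\langle N\rangle}Q_{\langle N\rangle}),\qquad s(Q,R)=\sum_{k\in\mathbb Z}\varphi\bigl([\tau_k(Q),R]\bigr).$$ **Proposition 4.2.** Let $\varphi$ be a translation-invariant finitely correlated state of $\mathcal A$ that is mixing, i.e. $\lim_{k\to\infty}\varphi(Q_1\tau_k(Q_2))=\varphi(Q_1)\varphi(Q_2)$ for all $Q_1,Q_2\in\mathcal A$. Then: 1. (Uniform exponential mixing.) There are constants $C,M>0$ such that $$|\varphi(Q_1\tau_n(Q_2))-\varphi(Q_1)\varphi(Q_2)|\le C e^{-Mn}\|Q_1\|\,\|Q_2\|$$ for all $Q_1\in\mathcal A_{(-\infty,-1]}$, all $Q_2\in\mathcal A_{[0,\infty)}$ and all integers $n\ge1$. 2. (Central limit theorem.) For every $\theta\in(0,1)$ and every selfadjoint $Q\in F_\theta$ the limit $t(Q,Q)$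 exists in $[0,\infty)$, and for every $T\in\mathbb R$ $$\lim_{N\to\infty}\varphi\bigl(e^{iTQ_{\langle N\rangle}}\bigr)=e^{-\frac{T^2}{2}t(Q,Q)}.$$ 3. (Joint central limit theorem.) For every $\theta\in(0,1)$ and all selfadjoint $Q(1),\dots,Q(r)\in F_\theta$ the series $s(Q(k),Q(l))$ converge absolutely, the limit $t\bigl(\sum_kQ(k),\sum_kQ(k)\bigr)$ exists in $[0,\infty)$, and, with the factors ordered by increasing $k$ from left to right, $$\lim_{N\to\infty}\varphi\Bigl(\prod_{k=1}^{r}e^{iQ(k)_{\langle N\rangle}}\Bigr)=e^{-\frac12t\left(\sum_kQ(k),\sum_kQ(k)\right)}\;e^{-\frac12\sum_{k<l}s(Q(k),Q(l))}.$$ -/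

import Mathlib

noncomputable section

namespace QSpin

open Filter Topology Set
open scoped ENNReal ComplexOrder

/-! ### The Hilbert space of configurations and permutation unitaries -/

/-- Configurations of a `d`-level system on the lattice `ℤ`. -/
abbrev Conf (d : ℕ) : Type := ℤ → Fin d

/-- The Hilbert space `ℓ²(Conf d)`, with an orthonormal basis labelled by configurations. The UHF
algebra is realised on it by letting every matrix act on its own tensor factor. -/
abbrev ConfSpace (d : ℕ) : Type := lp (fun _ : Conf d => ℂ) 2

theorem memlp_comp_equiv {d : ℕ} (e : Conf d ≃ Conf d) (f : ConfSpace d) :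
    Memℓp (fun σ => f (e σ)) 2 := by
  have h := (memℓp_gen_iff (p := 2) (by simp)).1 (lp.memℓp f)
  exact memℓp_gen ((e.summable_iff (f := fun σ => ‖f σ‖ ^ (2 : ℝ≥0∞).toReal)).2 h)

/-- Reindexing by a permutation of configurations, `(permOp e f) σ = f (e σ)`, is unitary. -/
def permOp {d : ℕ} (e : Conf d ≃ Conf d) : ConfSpace d ≃ₗᵢ[ℂ] ConfSpace d where
  toFun f := ⟨fun σ => f (e σ), memlp_comp_equiv e f⟩
  map_add' _ _ := rfl
  map_smul' _ _ := rfl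
  invFun f := ⟨fun σ => f (e.symm σ), memlp_comp_equiv e.symm f⟩
  left_inv f := by ext σ; simp
  right_inv f := by ext σ; simp
  norm_map' f := by
    have hp : 0 < (2 : ℝ≥0∞).toReal := by simp
    rw [lp.norm_eq_tsum_rpow hp, lp.norm_eq_tsum_rpow hp f]
    congr 1
    exact e.tsum_eq (fun σ => ‖f σ‖ ^ (2 : ℝ≥0∞).toReal)

@[simp] theorem permOp_apply {d : ℕ} (e : Conf d ≃ Conf d) (f : ConfSpace d) (σ : Conf d) :
    permOp e f σ = f (e σ) := rfl

@[simp] theorem permOp_symm_apply {d : ℕ} (e : Conf d ≃ Conf d) (f : ConfSpace d) (σ : Conf d) :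
    (permOp e).symm f σ = f (e.symm σ) := rfl

/-! ### Matrices acting at one site -/

/-- Exchange the values `a` and `b` of a configuration at the site `j`. -/
def flip {d : ℕ} (j : ℤ) (b a : Fin d) : Conf d ≃ Conf d :=
  Function.Involutive.toPerm (fun σ => Function.update σ j (Equiv.swap b a (σ j)))
    (fun σ => by simp)

theorem flip_apply {d : ℕ} (j : ℤ) (b a : Fin d) (σ : Conf d) :
    flip j b a σ = Function.update σ j (Equiv.swap b a (σ j)) := rfl

theorem flip_of_eq {d : ℕ} (j : ℤ) (b a : Fin d) (σ : Conf d) (h : σ j = b) :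
    flip j b a σ = Function.update σ j a := by
  rw [flip_apply, h, Equiv.swap_apply_left]

theorem norm_unit_le {d : ℕ} (j : ℤ) (b a : Fin d) (f : ConfSpace d) (σ : Conf d) :
    ‖(if σ j = b then f (Function.update σ j a) else 0 : ℂ)‖ ≤ ‖permOp (flip j b a) f σ‖ := by
  split_ifs with h
  · simp [flip_of_eq j b a σ h]
  · simp

/-- The matrix unit `|b⟩⟨a|` acting at the site `j`. -/
def unitAt {d : ℕ} (j : ℤ) (b a : Fin d) : ConfSpace d →L[ℂ] ConfSpace d :=
  LinearMap.mkContinuous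
    { toFun := fun f => ⟨fun σ => if σ j = b then f (Function.update σ j a) else 0,
        (lp.memℓp (permOp (flip j b a) f)).mono' (norm_unit_le j b a f)⟩
      map_add' := fun f g => by
        ext σ
        change (if σ j = b then (f + g : ConfSpace d) (Function.update σ j a) else 0) =
          (if σ j = b then f (Function.update σ j a) else 0) +
            (if σ j = b then g (Function.update σ j a) else 0)
        by_cases h : σ j = b <;> simp [h]
      map_smul' := fun c f => by
        ext σ
        change (if σ j = b then (c • f : ConfSpace d) (Function.update σ j a) else 0) =
          c • (if σ j = b then f (Function.update σ j a) else 0)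
        by_cases h : σ j = b <;> simp [h] }
    1 (fun f => by
      rw [one_mul, ← (permOp (flip j b a)).norm_map f]
      exact lp.norm_mono (by simp) (norm_unit_le j b a f))

theorem unitAt_apply {d : ℕ} (j : ℤ) (b a : Fin d) (f : ConfSpace d) (σ : Conf d) :
    unitAt j b a f σ = if σ j = b then f (Function.update σ j a) else 0 := rfl

/-- The matrix `Q` acting on the tensor factor at the site `j`. -/
def siteOp {d : ℕ} (j : ℤ) (Q : Matrix (Fin d) (Fin d) ℂ) : ConfSpace d →L[ℂ] ConfSpace d :=
  ∑ b, ∑ a, Q b a • unitAt j b a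

/-- The operator of `Q` at the site `j` is `Q` on the `j`-th tensor factor and the identity on
all other factors. -/
theorem siteOp_apply {d : ℕ} (j : ℤ) (Q : Matrix (Fin d) (Fin d) ℂ) (f : ConfSpace d)
    (σ : Conf d) : siteOp j Q f σ = ∑ a, Q (σ j) a * f (Function.update σ j a) := by
  simp only [siteOp, _root_.sum_apply, _root_.smul_apply,
    lp.coeFn_sum, Finset.sum_apply, lp.coeFn_smul, Pi.smul_apply, unitAt_apply, smul_eq_mul]
  rw [Finset.sum_comm]
  simp

theorem star_unitAt {d : ℕ} (j : ℤ) (b a : Fin d) : star (unitAt j b a) = unitAt j a b := by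
  rw [ContinuousLinearMap.star_eq_adjoint]
  symm
  rw [ContinuousLinearMap.eq_adjoint_iff]
  intro f g
  rw [lp.inner_eq_tsum, lp.inner_eq_tsum, ← (flip j b a).tsum_eq]
  refine tsum_congr fun σ => ?_
  simp only [unitAt_apply, flip_apply, Function.update_self, Function.update_idem]
  by_cases h : σ j = b
  · subst h
    simp
  · have h' : ¬ Equiv.swap b a (σ j) = a := by
      rw [Equiv.swap_apply_eq_iff, Equiv.swap_apply_right]
      exact h
    simp [h, h']

/-- The embedding `Q ↦ Q^{(j)}` of the matrix algebra as the tensor factor at the site `j`. -/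
def siteHom {d : ℕ} (j : ℤ) :
    Matrix (Fin d) (Fin d) ℂ →⋆ₐ[ℂ] (ConfSpace d →L[ℂ] ConfSpace d) where
  toFun := siteOp j
  map_one' := by
    ext f σ
    simp [siteOp_apply, Matrix.one_apply]
  map_mul' P Q := by
    ext f σ
    simp only [_root_.mul_apply_eq_comp, siteOp_apply, Matrix.mul_apply, Function.update_self,
      Function.update_idem, Finset.mul_sum, Finset.sum_mul, mul_assoc]
    exact Finset.sum_comm
  map_zero' := by
    ext f σ
    simp [siteOp_apply]
  map_add' P Q := by
    ext f σ
    simp [siteOp_apply, add_mul, Finset.sum_add_distrib]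
  commutes' c := by
    ext f σ
    simp [siteOp_apply, Matrix.one_apply, Algebra.algebraMap_eq_smul_one]
  map_star' Q := by
    simp only [siteOp, star_sum, star_smul, star_unitAt, Matrix.star_apply]
    exact Finset.sum_comm

/-! ### The quasi-local algebra, its local subalgebras and the translations -/

/-- The concrete C⋆-algebra generated by all one-site matrices. -/
def chainAlgebra (d : ℕ) : StarSubalgebra ℂ (ConfSpace d →L[ℂ] ConfSpace d) :=
  (StarAlgebra.adjoin ℂ {x | ∃ (j : ℤ) (Q : Matrix (Fin d) (Fin d) ℂ),
    x = siteHom j Q}).topologicalClosure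

/-- The UHF algebra of the spin chain: the C⋆-completion of the infinite tensor product over `ℤ`
of the algebras of `d × d` matrices. -/
abbrev SpinChain (d : ℕ) : Type := ↥(chainAlgebra d)

instance isClosed_chainAlgebra (d : ℕ) :
    IsClosed (chainAlgebra d : Set (ConfSpace d →L[ℂ] ConfSpace d)) :=
  StarSubalgebra.isClosed_topologicalClosure _

theorem siteHom_mem {d : ℕ} (j : ℤ) (Q : Matrix (Fin d) (Fin d) ℂ) :
    siteHom j Q ∈ chainAlgebra d :=
  StarSubalgebra.le_topologicalClosure _ (StarAlgebra.subset_adjoin ℂ _ ⟨j, Q, rfl⟩)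

/-- The element `Q^{(j)}` of the spin chain algebra. -/
def site {d : ℕ} (j : ℤ) : Matrix (Fin d) (Fin d) ℂ →⋆ₐ[ℂ] SpinChain d :=
  StarAlgHom.codRestrict (siteHom j) (chainAlgebra d) (siteHom_mem j)

/-- The C⋆-subalgebra generated by the elements localized in a set `Λ` of sites. -/
def region {d : ℕ} (Λ : Set ℤ) : StarSubalgebra ℂ (SpinChain d) :=
  (StarAlgebra.adjoin ℂ {x | ∃ j ∈ Λ, ∃ Q : Matrix (Fin d) (Fin d) ℂ,
    x = site j Q}).topologicalClosure

/-- The shift of configurations by `k` sites. -/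
def shiftConf {d : ℕ} (k : ℤ) : Conf d ≃ Conf d where
  toFun σ i := σ (i + k)
  invFun σ i := σ (i - k)
  left_inv σ := by ext i; simp
  right_inv σ := by ext i; simp

/-- Conjugation by the unitary that shifts configurations. -/
def shiftConj {d : ℕ} (k : ℤ) :
    (ConfSpace d →L[ℂ] ConfSpace d) ≃⋆ₐ[ℂ] (ConfSpace d →L[ℂ] ConfSpace d) :=
  (permOp (shiftConf k)).conjStarAlgEquiv

theorem shiftConj_apply {d : ℕ} (k : ℤ) (x : ConfSpace d →L[ℂ] ConfSpace d) (f : ConfSpace d) :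
    shiftConj k x f = permOp (shiftConf k) (x ((permOp (shiftConf k)).symm f)) := by
  simp [shiftConj]

theorem shiftConj_siteHom {d : ℕ} (k j : ℤ) (Q : Matrix (Fin d) (Fin d) ℂ) :
    shiftConj k (siteHom j Q) = siteHom (j + k) Q := by
  ext f σ
  rw [shiftConj_apply]
  change permOp (shiftConf k) (siteOp j Q ((permOp (shiftConf k)).symm f)) σ = siteOp (j + k) Q f σ
  rw [permOp_apply, siteOp_apply, siteOp_apply]
  refine Finset.sum_congr rfl fun a _ => ?_
  rw [permOp_symm_apply]
  refine congrArg (fun ρ : Conf d => Q (σ (j + k)) a * f ρ) ?_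
  funext i
  by_cases h : i = j + k
  · subst h
    simp [shiftConf]
  · have h' : ¬ i - k = j := fun h' => h (by omega)
    simp [shiftConf, h, h']

theorem shiftConj_mem {d : ℕ} (k : ℤ) {x : ConfSpace d →L[ℂ] ConfSpace d}
    (hx : x ∈ chainAlgebra d) : shiftConj k x ∈ chainAlgebra d := by
  have hc : Continuous (shiftConj (d := d) k) := by
    have h : ∀ x, shiftConj (d := d) k x =
        ((permOp (shiftConf (d := d) k) : ConfSpace d →L[ℂ] ConfSpace d) * x) *
          ((permOp (shiftConf (d := d) k)).symm : ConfSpace d →L[ℂ] ConfSpace d) := fun x => by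
      ext1 f
      exact shiftConj_apply k x f
    simp only [funext h]
    fun_prop
  have hle : StarAlgebra.adjoin ℂ {x | ∃ (j : ℤ) (Q : Matrix (Fin d) (Fin d) ℂ),
      x = siteHom j Q} ≤ (chainAlgebra d).comap (shiftConj (d := d) k).toStarAlgHom := by
    refine StarAlgebra.adjoin_le ?_
    rintro _ ⟨j, Q, rfl⟩
    change shiftConj k (siteHom j Q) ∈ chainAlgebra d
    rw [shiftConj_siteHom]
    exact siteHom_mem _ _
  exact StarSubalgebra.topologicalClosure_minimal hle
    ((isClosed_chainAlgebra d).preimage hc) hx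

/-- The lattice translation `τ_k`, a shift by `k` sites to the right. -/
def translate {d : ℕ} (k : ℤ) : SpinChain d →⋆ₐ[ℂ] SpinChain d :=
  StarAlgHom.codRestrict  ((shiftConj k).toStarAlgHom.comp (chainAlgebra d).subtype)
    (chainAlgebra d) (fun x => shiftConj_mem k x.2)

/-- The translation `τ_k` is determined by `τ_k (Q^{(j)}) = Q^{(j + k)}`. -/
theorem translate_site {d : ℕ} (k j : ℤ) (Q : Matrix (Fin d) (Fin d) ℂ) :
    translate k (site j Q) = site (j + k) Q :=
  Subtype.ext (shiftConj_siteHom k j Q)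

/-! ### States -/

/-- A state: a positive normalized linear functional. -/
structure IsState {d : ℕ} (φ : SpinChain d →ₗ[ℂ] ℂ) : Prop where
  nonneg : ∀ Q, 0 ≤ φ (star Q * Q)
  map_one : φ 1 = 1

/-- Translation invariance of a functional. -/
def IsTranslationInvariant {d : ℕ} (φ : SpinChain d →ₗ[ℂ] ℂ) : Prop :=
  ∀ (k : ℤ) (Q : SpinChain d), φ (translate k Q) = φ Q

/-- The map that sends `Q` in the algebra of `[k+1,∞)` to the functional `φ_Q : R ↦ φ (Q R)` on the
algebra of `(-∞,k]`. -/
def corrMap {d : ℕ} (φ : SpinChain d →ₗ[ℂ] ℂ) (k : ℤ) :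
    region (d := d) (Ici (k + 1)) →ₗ[ℂ] (region (d := d) (Iic k) →ₗ[ℂ] ℂ) :=
  LinearMap.mk₂ ℂ (fun Q R => φ ((Q : SpinChain d) * (R : SpinChain d)))
    (fun _ _ _ => by simp [add_mul]) (fun _ _ _ => by simp)
    (fun _ _ _ => by simp [mul_add]) (fun _ _ _ => by simp)

/-- Finitely correlated: for every `k` the space of the functionals `φ_Q` on the algebra of
`(-∞,k]`, where `Q` runs over the algebra of `[k+1,∞)`, is finite dimensional. -/
def IsFinitelyCorrelated {d : ℕ} (φ : SpinChain d →ₗ[ℂ] ℂ) : Prop :=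
  ∀ k : ℤ, FiniteDimensional ℂ (LinearMap.range (corrMap φ k))

/-- Mixing: `φ (Q₁ τ_k(Q₂)) → φ(Q₁) φ(Q₂)` as `k → ∞`, for all observables. -/
def IsMixing {d : ℕ} (φ : SpinChain d →ₗ[ℂ] ℂ) : Prop :=
  ∀ Q₁ Q₂ : SpinChain d,
    Tendsto (fun k : ℕ => φ (Q₁ * translate (k : ℤ) Q₂)) atTop (𝓝 (φ Q₁ * φ Q₂))

/-- Uniform exponential mixing between the half-lines `(-∞,-1]` and `[0,∞)`. -/
def IsExponentiallyMixing {d : ℕ} (φ : SpinChain d →ₗ[ℂ] ℂ) : Prop :=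
  ∃ C M : ℝ, 0 < C ∧ 0 < M ∧
    ∀ Q₁ ∈ region (d := d) (Iic (-1)), ∀ Q₂ ∈ region (d := d) (Ici 0), ∀ n : ℕ, 0 < n →
      ‖φ (Q₁ * translate (n : ℤ) Q₂) - φ Q₁ * φ Q₂‖ ≤ C * Real.exp (-M * n) * ‖Q₁‖ * ‖Q₂‖

/-! ### Exponentially localized observables and the central limit theorem -/

/-- The seminorms `‖Q‖^{(n)}`: the norm for `n = 0`, and the distance of `Q` to the algebra of
`[-n,n]` for `n > 0`. -/
def locNorm {d : ℕ} (n : ℕ) (Q : SpinChain d) : ℝ :=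
  if n = 0 then ‖Q‖
  else Metric.infDist Q (region (d := d) (Icc (-(n : ℤ)) (n : ℤ)) : Set (SpinChain d))

/-- `Q` is exponentially localized with rate `θ`: the series `∑ ‖Q‖^{(n)} θ^{-n}` of nonnegative
terms is finite. -/
def IsExpLocalized {d : ℕ} (θ : ℝ) (Q : SpinChain d) : Prop :=
  Summable fun n : ℕ => locNorm n Q * (θ ^ n)⁻¹

/-- The local fluctuation `Q_{<N>} = (2N+1)^{-1/2} ∑_{|j| ≤ N} (τ_j(Q) - φ(Q))`. -/
def fluct {d : ℕ} (φ : SpinChain d →ₗ[ℂ] ℂ) (N : ℕ) (Q : SpinChain d) : SpinChain d :=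
  (((Real.sqrt (2 * (N : ℝ) + 1))⁻¹ : ℝ) : ℂ) •
    ∑ j ∈ Finset.Icc (-(N : ℤ)) (N : ℤ), (translate j Q - φ Q • (1 : SpinChain d))

/-- `t` is the limit `t(Q,Q) = lim φ (Q_{<N>} Q_{<N>})`. -/
def HasVariance {d : ℕ} (φ : SpinChain d →ₗ[ℂ] ℂ) (Q : SpinChain d) (t : ℝ) : Prop :=
  Tendsto (fun N : ℕ => φ (fluct φ N Q * fluct φ N Q)) atTop (𝓝 (t : ℂ))

/-- The term `φ ([τ_k(Q), R])` of the series for the commutator form. -/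
def commTerm {d : ℕ} (φ : SpinChain d →ₗ[ℂ] ℂ) (Q R : SpinChain d) (k : ℤ) : ℂ :=
  φ (translate k Q * R - R * translate k Q)

/-- The commutator form `s(Q,R) = ∑_{k ∈ ℤ} φ ([τ_k(Q), R])`. -/
def commForm {d : ℕ} (φ : SpinChain d →ₗ[ℂ] ℂ) (Q R : SpinChain d) : ℂ :=
  ∑' k : ℤ, commTerm φ Q R k

/-- The central limit theorem for a single observable `Q`: the limit `t = t(Q,Q)` exists, and
`φ (exp (i T Q_{<N>})) → exp (-T² t / 2)` for all real `T`. -/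
def CentralLimit {d : ℕ} (φ : SpinChain d →ₗ[ℂ] ℂ) (Q : SpinChain d) : Prop :=
  ∃ t : ℝ, 0 ≤ t ∧ HasVariance φ Q t ∧
    ∀ T : ℝ, Tendsto (fun N : ℕ => φ (NormedSpace.exp ((Complex.I * (T : ℂ)) • fluct φ N Q)))
      atTop (𝓝 (Complex.exp (-((T : ℂ) ^ 2 / 2) * (t : ℂ))))

/-- The joint central limit theorem for `Q 0, …, Q (r-1)`: with `t = t(∑ₖ Q k, ∑ₖ Q k)` and with
absolutely convergent commutator forms, the expectations of the ordered products
`exp (i (Q 0)_{<N>}) ⋯ exp (i (Q (r-1))_{<N>})` converge to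
`exp (-t/2) exp (-(1/2) ∑_{k<l} s(Q k, Q l))`. -/
def JointCentralLimit {d : ℕ} (φ : SpinChain d →ₗ[ℂ] ℂ) {r : ℕ} (Q : Fin r → SpinChain d) :
    Prop :=
  ∃ t : ℝ, 0 ≤ t ∧ HasVariance φ (∑ k, Q k) t ∧
    (∀ k l, Summable (commTerm φ (Q k) (Q l))) ∧
    Tendsto
      (fun N : ℕ => φ (List.ofFn fun k => NormedSpace.exp (Complex.I • fluct φ N (Q k))).prod)
      atTop
      (𝓝 (Complex.exp (-(t : ℂ) / 2) *
        Complex.exp (-(1 / 2) * ∑ k, ∑ l ∈ Finset.Ioi k, commForm φ (Q k) (Q l))))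

end QSpin

end

/-! Exponential mixing. The functionals x ↦ φ(Qx) on the left half-line, with Q on the right
half-line, form a finite-dimensional space W. By translation invariance, replacing Q by τ₁(Q)
amounts to composing the functional with a left translation, so it acts linearly on W. Subtracting
the rank-one part ψ ↦ ψ(1)φ gives an operator T with Tⁿ(φ_Q) = φ_{τₙ(Q)} - φ(Q)φ for n ≥ 1. Mixing
says that Tⁿ → 0 pointwise, and on a finite-dimensional space this forces geometric decay of the
norm (`exists_norm_pow_le_of_weak`, `exists_exponential_decay`).

Central limit theorems. These use only exponential mixing, commutation of disjoint regions and
invariance, collected in `MixingChain`; the argument is Stein's method. Let P be a product of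
exponentials exp(iX_k) of normalized sums of centered local observables, and X another such sum.
Then φ(PX) ≈ i φ(P) φ((∑X_k)X) (`stein`). Indeed, for the term of X at a site j, expand P to first
order in those summands of the X_k that sit near j. The remaining summands split into a left and a
right part, which decouple from site j by mixing; the zeroth order vanishes because the observable
is centered, and the first order gives the covariance. Noncommutativity enters only through
commutators of normalized sums, which are small by locality.

With h(s) = φ(P exp(isX)), a the covariance of ∑X_k with X and b the variance of X, this reads h' ≈
-(a + sb)h, so each additional factor multiplies the expectation by exp(-(a + b/2)) in the limit
(`norm_state_mul_expI_sub_le`), and induction on the number of factors handles products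
(`tendsto_state_prod_expI_array`). The supports may grow like N^{1/8}: slow enough for the
polynomial errors, fast enough for exponentially small errors to beat the volume. This allows
replacing exponentially localized observables by local ones.

The covariances converge to c k l, the sum over all sites of the two-point covariances. In the
exponent -∑ₖ (c k k / 2 + ∑_{l<k} c l k) the symmetric part of c yields t and the antisymmetric part
yields s. The theorem for one observable Q is the joint theorem applied to the single observable TQ.
-/

noncomputable section

namespace QSpin

open Filter Topology Set
open scoped ENNReal ComplexOrder

/-! ### Exponentials of selfadjoint elements -/

section Exponentials

variable {A : Type*} [CStarAlgebra A]

/-- The exponential `exp (i x)`. -/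
def expI (x : A) : A := NormedSpace.exp (Complex.I • x)

theorem star_I_smul {x : A} (hx : IsSelfAdjoint x) : star (Complex.I • x) = -(Complex.I • x) := by
  simp [star_smul, hx.star_eq]

theorem expI_mem_unitary {x : A} (hx : IsSelfAdjoint x) : expI x ∈ unitary A :=
  let _ : NormedAlgebra ℚ A := NormedAlgebra.restrictScalars ℚ ℂ A
  NormedSpace.exp_mem_unitary_of_mem_skewAdjoint (skewAdjoint.mem_iff.2 (star_I_smul hx))

theorem norm_le_one_of_mem_unitary {u : A} (hu : u ∈ unitary A) : ‖u‖ ≤ 1 := by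
  rcases subsingleton_or_nontrivial A with h | h
  · simp [Subsingleton.elim u 0]
  · exact (CStarRing.norm_of_mem_unitary hu).le

theorem norm_expI_le {x : A} (hx : IsSelfAdjoint x) : ‖expI x‖ ≤ 1 :=
  norm_le_one_of_mem_unitary (expI_mem_unitary hx)

theorem expI_neg_mul_self (x : A) : expI (-x) * expI x = 1 := by
  let _ : NormedAlgebra ℚ A := NormedAlgebra.restrictScalars ℚ ℂ A
  rw [expI, expI, ← NormedSpace.exp_add_of_commute, smul_neg, neg_add_cancel, NormedSpace.exp_zero]
  simp [Commute, SemiconjBy]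

theorem expI_mul_neg_self (x : A) : expI x * expI (-x) = 1 := by
  simpa using expI_neg_mul_self (-x)

theorem expI_add_of_commute {x y : A} (h : Commute x y) : expI (x + y) = expI x * expI y := by
  let _ : NormedAlgebra ℚ A := NormedAlgebra.restrictScalars ℚ ℂ A
  rw [expI, expI, expI, smul_add, NormedSpace.exp_add_of_commute]
  exact (h.smul_left _).smul_right _

@[simp] theorem expI_zero : expI (0 : A) = 1 := by simp [expI]

theorem hasDerivAt_expI (x : A) (s : ℝ) :
    HasDerivAt (fun s : ℝ => expI (s • x)) (expI (s • x) * (Complex.I • x)) s := by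
  have h := hasDerivAt_exp_smul_const (𝕂 := ℝ) (Complex.I • x) s
  simpa only [expI, smul_comm Complex.I] using h

theorem hasDerivAt_expI' (x : A) (s : ℝ) :
    HasDerivAt (fun s : ℝ => expI (s • x)) ((Complex.I • x) * expI (s • x)) s := by
  have h := hasDerivAt_exp_smul_const' (𝕂 := ℝ) (Complex.I • x) s
  simpa only [expI, smul_comm Complex.I] using h

theorem isSelfAdjoint_real_smul {x : A} (hx : IsSelfAdjoint x) (s : ℝ) : IsSelfAdjoint (s • x) :=
  (IsSelfAdjoint.all s).smul hx

theorem norm_expI_mul_le {x : A} (hx : IsSelfAdjoint x) (y : A) : ‖expI x * y‖ ≤ ‖y‖ :=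
  (norm_mul_le _ _).trans (mul_le_of_le_one_left (norm_nonneg _) (norm_expI_le hx))

theorem norm_mul_expI_le {x : A} (hx : IsSelfAdjoint x) (y : A) : ‖y * expI x‖ ≤ ‖y‖ :=
  (norm_mul_le _ _).trans (mul_le_of_le_one_right (norm_nonneg _) (norm_expI_le hx))

/-- Cancelling `exp (-i x)` in norm estimates. -/
theorem norm_le_norm_expI_neg_mul {x : A} (hx : IsSelfAdjoint x) (y : A) :
    ‖y‖ ≤ ‖expI (-x) * y‖ := by
  have h := norm_expI_mul_le hx (expI (-x) * y)
  rwa [← mul_assoc, expI_mul_neg_self, one_mul] at h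

theorem norm_I_smul (x : A) : ‖Complex.I • x‖ = ‖x‖ := by simp [norm_smul]

/-- Duhamel interpolation: the path exp(-isy) exp(isx) from s = 0 to s = 1 has velocity i(x - y)
between two unitaries. -/
theorem norm_expI_sub_expI_le {x y : A} (hx : IsSelfAdjoint x) (hy : IsSelfAdjoint y) :
    ‖expI x - expI y‖ ≤ ‖x - y‖ := by
  have hd : ∀ s : ℝ, HasDerivAt (fun s : ℝ => expI (s • -y) * expI (s • x))
      (expI (s • -y) * (Complex.I • (x - y)) * expI (s • x)) s := by
    intro s
    refine ((hasDerivAt_expI (-y) s).mul (hasDerivAt_expI' x s)).congr_deriv ?_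
    simp only [smul_neg, smul_sub, mul_sub, sub_mul, mul_neg, neg_mul, mul_assoc]
    abel
  have h := norm_image_sub_le_of_norm_deriv_le_segment_01' (C := ‖x - y‖)
    (fun s _ => (hd s).hasDerivWithinAt) (fun s _ => by
      refine (norm_mul_expI_le (isSelfAdjoint_real_smul hx s) _).trans ?_
      refine (norm_expI_mul_le (isSelfAdjoint_real_smul hy.neg s) _).trans ?_
      rw [norm_I_smul])
  simp only [one_smul, zero_smul, expI_zero, mul_one] at h
  refine (norm_le_norm_expI_neg_mul hy _).trans ?_
  rwa [mul_sub, expI_neg_mul_self]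

/-- The same interpolation for exp(-isF) G exp(isF), whose velocity is the conjugated commutator. -/
theorem norm_commutator_expI_le {F : A} (hF : IsSelfAdjoint F) (G : A) :
    ‖G * expI F - expI F * G‖ ≤ ‖G * F - F * G‖ := by
  have hd : ∀ s : ℝ, HasDerivAt (fun s : ℝ => expI (s • -F) * (G * expI (s • F)))
      (expI (s • -F) * (Complex.I • (G * F - F * G)) * expI (s • F)) s := by
    intro s
    refine ((hasDerivAt_expI (-F) s).mul ((hasDerivAt_expI' F s).const_mul G)).congr_deriv ?_
    simp only [smul_neg, smul_sub, mul_sub, sub_mul, mul_neg, neg_mul, mul_assoc, smul_mul_assoc,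
      mul_smul_comm]
    abel
  have h := norm_image_sub_le_of_norm_deriv_le_segment_01' (C := ‖G * F - F * G‖)
    (fun s _ => (hd s).hasDerivWithinAt) (fun s _ => by
      refine (norm_mul_expI_le (isSelfAdjoint_real_smul hF s) _).trans ?_
      refine (norm_expI_mul_le (isSelfAdjoint_real_smul hF.neg s) _).trans ?_
      rw [norm_I_smul])
  simp only [one_smul, zero_smul, expI_zero, mul_one, one_mul] at h
  refine (norm_le_norm_expI_neg_mul hF _).trans ?_
  rwa [mul_sub, ← mul_assoc, ← mul_assoc, expI_neg_mul_self, one_mul, mul_assoc]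

/-- First-order expansion in the small perturbation G, with no smallness of F. In the interaction
picture exp(-isF) exp(is(F+G)) the velocity differs from iG by a commutator of G with exp(isF) and
by a term quadratic in G. -/
theorem norm_expI_add_sub_le {F G : A} (hF : IsSelfAdjoint F) (hG : IsSelfAdjoint G) :
    ‖expI (F + G) - expI F * (1 + Complex.I • G)‖ ≤ ‖G * F - F * G‖ + ‖G‖ ^ 2 := by
  have hd : ∀ s : ℝ, HasDerivAt
      (fun s : ℝ => expI (s • -F) * expI (s • (F + G)) - s • (Complex.I • G))
      (Complex.I • (expI (s • -F) * (G * expI (s • (F + G)) - expI (s • F) * G))) s := by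
    intro s
    refine (((hasDerivAt_expI (-F) s).mul (hasDerivAt_expI' (F + G) s)).sub
      ((hasDerivAt_id s).smul_const (Complex.I • G))).congr_deriv ?_
    have h1 : expI (s • -F) * (expI (s • F) * G) = G := by
      rw [← mul_assoc, smul_neg, expI_neg_mul_self, one_mul]
    rw [mul_sub, h1]
    simp only [smul_neg, smul_sub, smul_add, add_mul, mul_add, mul_neg, neg_mul, mul_assoc,
      smul_mul_assoc, mul_smul_comm, one_smul]
    abel
  have h := norm_image_sub_le_of_norm_deriv_le_segment_01' (C := ‖G * F - F * G‖ + ‖G‖ ^ 2)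
    (fun s _ => (hd s).hasDerivWithinAt) (fun s hs => by
      have hsF := isSelfAdjoint_real_smul hF s
      rw [norm_I_smul]
      refine (norm_expI_mul_le (isSelfAdjoint_real_smul hF.neg s) _).trans ?_
      have e : G * expI (s • (F + G)) - expI (s • F) * G =
          (G * expI (s • F) - expI (s • F) * G) + G * (expI (s • (F + G)) - expI (s • F)) := by
        rw [mul_sub]; abel
      rw [e]
      refine (norm_add_le _ _).trans (add_le_add ?_ ?_)
      · refine (norm_commutator_expI_le hsF G).trans ?_
        rw [mul_smul_comm, smul_mul_assoc, ← smul_sub, norm_smul, Real.norm_of_nonneg hs.1]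
        exact mul_le_of_le_one_left (norm_nonneg _) hs.2.le
      · refine (norm_mul_le _ _).trans ?_
        rw [sq]
        refine mul_le_mul_of_nonneg_left ?_ (norm_nonneg _)
        refine (norm_expI_sub_expI_le (isSelfAdjoint_real_smul (hF.add hG) s) hsF).trans ?_
        rw [smul_add, add_sub_cancel_left, norm_smul, Real.norm_of_nonneg hs.1]
        exact mul_le_of_le_one_left (norm_nonneg _) hs.2.le)
  simp only [one_smul, zero_smul, expI_zero, mul_one, sub_zero] at h
  refine (norm_le_norm_expI_neg_mul hF _).trans ?_
  rw [mul_sub, ← mul_assoc, expI_neg_mul_self, one_mul]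
  rwa [← sub_sub, sub_right_comm]

theorem norm_list_prod_expI_le {ι : Type*} (l : List ι) {x : ι → A}
    (hx : ∀ i ∈ l, IsSelfAdjoint (x i)) : ‖(l.map fun i => expI (x i)).prod‖ ≤ 1 := by
  refine norm_le_one_of_mem_unitary (Submonoid.list_prod_mem _ ?_)
  simp only [List.mem_map, forall_exists_index, and_imp]
  rintro _ i hi rfl
  exact expI_mem_unitary (hx i hi)

theorem norm_list_prod_expI_sub_le {ι : Type*} (l : List ι) {x y : ι → A} {δ : ℝ}
    (hx : ∀ i ∈ l, IsSelfAdjoint (x i)) (hy : ∀ i ∈ l, IsSelfAdjoint (y i))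
    (h : ∀ i ∈ l, ‖x i - y i‖ ≤ δ) :
    ‖(l.map fun i => expI (x i)).prod - (l.map fun i => expI (y i)).prod‖ ≤ l.length * δ := by
  induction l with
  | nil => simp
  | cons a l ih =>
    simp only [List.forall_mem_cons] at hx hy h
    simp only [List.map_cons, List.prod_cons, List.length_cons, Nat.cast_add, Nat.cast_one]
    have e : ∀ a b c e : A, a * b - c * e = a * (b - e) + (a - c) * e := by intros; noncomm_ring
    rw [e, add_mul, one_mul]
    refine (norm_add_le _ _).trans (add_le_add ?_ ?_)
    · exact (norm_expI_mul_le hx.1 _).trans (ih hx.2 hy.2 h.2)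
    · refine (norm_mul_le _ _).trans ?_
      refine (mul_le_of_le_one_right (norm_nonneg _) (norm_list_prod_expI_le l hy.2)).trans ?_
      exact (norm_expI_sub_expI_le hx.1 hy.1).trans h.1

/-- Leibniz rule for the commutator; all other factors are unitary. -/
theorem norm_commutator_list_prod_le {ι : Type*} (l : List ι) {F : ι → A} {G : A} {κ : ℝ}
    (hF : ∀ i ∈ l, IsSelfAdjoint (F i)) (h : ∀ i ∈ l, ‖G * F i - F i * G‖ ≤ κ) :
    ‖G * (l.map fun i => expI (F i)).prod - (l.map fun i => expI (F i)).prod * G‖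
      ≤ l.length * κ := by
  induction l with
  | nil => simp
  | cons a l ih =>
    simp only [List.forall_mem_cons] at hF h
    simp only [List.map_cons, List.prod_cons, List.length_cons, Nat.cast_add, Nat.cast_one]
    have e : ∀ a b c : A, a * (b * c) - b * c * a = b * (a * c - c * a) + (a * b - b * a) * c := by
      intros; noncomm_ring
    rw [e, add_mul, one_mul]
    refine (norm_add_le _ _).trans (add_le_add ?_ ?_)
    · exact (norm_expI_mul_le hF.1 _).trans (ih hF.2 h.2)
    · refine (norm_mul_le _ _).trans ?_
      refine (mul_le_of_le_one_right (norm_nonneg _) (norm_list_prod_expI_le l hF.2)).trans ?_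
      exact (norm_commutator_expI_le hF.1 G).trans h.1

theorem norm_list_sum_map_le {ι : Type*} (l : List ι) {G : ι → A} {δ : ℝ}
    (h : ∀ i ∈ l, ‖G i‖ ≤ δ) : ‖(l.map G).sum‖ ≤ l.length * δ := by
  induction l with
  | nil => simp
  | cons a l ih =>
    simp only [List.forall_mem_cons] at h
    simp only [List.map_cons, List.sum_cons, List.length_cons, Nat.cast_add, Nat.cast_one]
    rw [add_mul, one_mul, add_comm]
    exact (norm_add_le _ _).trans (add_le_add (ih h.2) h.1)

/-- Expand every factor to first order and move all the terms iGᵢ to the right end. Each move costs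
a commutator, and each product of two of the G's costs δ². -/
theorem norm_list_prod_expI_add_sub_le {ι : Type*} (l : List ι) {F G : ι → A} {δ κ : ℝ}
    (hδ0 : 0 ≤ δ) (hδ : δ ≤ 1) (hκ0 : 0 ≤ κ)
    (hF : ∀ i ∈ l, IsSelfAdjoint (F i)) (hG : ∀ i ∈ l, IsSelfAdjoint (G i))
    (hGδ : ∀ i ∈ l, ‖G i‖ ≤ δ) (hκ : ∀ i ∈ l, ∀ j ∈ l, ‖G i * F j - F j * G i‖ ≤ κ) :
    ‖(l.map fun i => expI (F i + G i)).prod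
        - (l.map fun i => expI (F i)).prod * (1 + Complex.I • (l.map G).sum)‖
      ≤ 4 ^ l.length * (κ + δ ^ 2) := by
  induction l with
  | nil => simpa using by positivity
  | cons a l ih =>
    simp only [List.forall_mem_cons] at hF hG hGδ hκ
    have ih := ih hF.2 hG.2 hGδ.2 (fun i hi => (hκ.2 i hi).2)
    simp only [List.map_cons, List.prod_cons, List.length_cons, List.sum_cons]
    have hP := norm_list_prod_expI_le l (x := fun i => F i + G i)
      fun i hi => (hF.2 i hi).add (hG.2 i hi)
    have hR := norm_list_prod_expI_le l hF.2
    have hS := norm_list_sum_map_le l hGδ.2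
    have hc := norm_commutator_list_prod_le l hF.2 hκ.1.2
    set P := (l.map fun i => expI (F i + G i)).prod
    set R := (l.map fun i => expI (F i)).prod
    set S := (l.map G).sum
    -- The three errors: expanding the first factor, the induction hypothesis for the tail, and
    -- moving G a past the unperturbed tail together with the second-order product with S.
    have e : expI (F a + G a) * P - expI (F a) * R * (1 + Complex.I • (G a + S)) =
        (expI (F a + G a) - expI (F a) * (1 + Complex.I • G a)) * P
        + (expI (F a) * ((1 + Complex.I • G a) * (P - R * (1 + Complex.I • S)))
        + expI (F a) * (Complex.I • (G a * R - R * G a) - G a * (R * S))) := by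
      simp only [smul_add, add_mul, mul_add, sub_mul, mul_sub, mul_one, one_mul, smul_mul_assoc,
        mul_smul_comm, smul_sub, mul_assoc, smul_smul, Complex.I_mul_I, neg_smul, one_smul, mul_neg]
      abel
    rw [e]
    have h1 : ‖(expI (F a + G a) - expI (F a) * (1 + Complex.I • G a)) * P‖ ≤ κ + δ ^ 2 := by
      refine (norm_mul_le _ _).trans ((mul_le_of_le_one_right (norm_nonneg _) hP).trans ?_)
      refine (norm_expI_add_sub_le hF.1 hG.1).trans (add_le_add hκ.1.1 ?_)
      exact pow_le_pow_left₀ (norm_nonneg _) hGδ.1 2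
    have h2 : ‖expI (F a) * ((1 + Complex.I • G a) * (P - R * (1 + Complex.I • S)))‖ ≤
        2 * (4 ^ l.length * (κ + δ ^ 2)) := by
      have h1G : ‖1 + Complex.I • G a‖ ≤ 2 := by
        refine (norm_add_le _ _).trans ?_
        rw [norm_I_smul]
        have := norm_le_one_of_mem_unitary (one_mem (unitary A))
        linarith [hGδ.1]
      refine (norm_expI_mul_le hF.1 _).trans ((norm_mul_le _ _).trans ?_)
      exact mul_le_mul h1G ih (norm_nonneg _) zero_le_two
    have h3 : ‖expI (F a) * (Complex.I • (G a * R - R * G a) - G a * (R * S))‖ ≤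
        l.length * κ + δ * (l.length * δ) := by
      refine (norm_expI_mul_le hF.1 _).trans ((norm_sub_le _ _).trans ?_)
      rw [norm_I_smul]
      refine add_le_add hc ((norm_mul_le _ _).trans ?_)
      refine mul_le_mul hGδ.1 ((norm_mul_le _ _).trans ?_) (norm_nonneg _) hδ0
      exact (mul_le_of_le_one_left (norm_nonneg _) hR).trans hS
    refine (norm_add_le _ _).trans ((add_le_add h1 ((norm_add_le _ _).trans
      (add_le_add h2 h3))).trans ?_)
    -- The errors add up to (1 + k + 2·4^k)(κ + δ²) with k the length of the tail, and this fits
    -- under 4^(k+1).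
    have h4 : (1 + l.length : ℝ) ≤ 2 * 4 ^ l.length := by
      have : 1 + l.length ≤ 2 * 4 ^ l.length := by
        have := Nat.lt_pow_self (n := l.length) (a := 4) (by norm_num)
        omega
      exact_mod_cast this
    have h5 : 0 ≤ κ + δ ^ 2 := by positivity
    rw [pow_succ (4 : ℝ)]
    linarith [mul_le_mul_of_nonneg_right h4 h5]

end Exponentials


/-! ### Exponentially mixing states on an algebra with a local structure -/

/-- A C⋆-algebra with a net of subalgebras labelled by sets of sites, translations, and a
translation invariant state which is exponentially mixing. -/
structure MixingChain (A : Type*) [CStarAlgebra A] where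
  /-- The observables localized in a set of sites. -/
  region : Set ℤ → StarSubalgebra ℂ A
  isClosed_region : ∀ Λ, IsClosed (region Λ : Set A)
  region_mono : ∀ {Λ Λ' : Set ℤ}, Λ ⊆ Λ' → region Λ ≤ region Λ'
  commute_of_disjoint : ∀ {Λ Λ' : Set ℤ}, Disjoint Λ Λ' → ∀ {x y : A}, x ∈ region Λ →
    y ∈ region Λ' → Commute x y
  /-- The translations. -/
  shift : ℤ → A →⋆ₐ[ℂ] A
  shift_mem : ∀ {Λ : Set ℤ} (k : ℤ) {x : A}, x ∈ region Λ →
    shift k x ∈ region ((fun i => i + k) '' Λ)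
  shift_zero : ∀ x : A, shift 0 x = x
  shift_shift : ∀ (j k : ℤ) (x : A), shift j (shift k x) = shift (j + k) x
  /-- The state. -/
  state : A →ₗ[ℂ] ℂ
  norm_state_le : ∀ x, ‖state x‖ ≤ ‖x‖
  state_one : state 1 = 1
  state_star_mul_self_nonneg : ∀ x, 0 ≤ state (star x * x)
  state_shift : ∀ (k : ℤ) (x : A), state (shift k x) = state x
  /-- The prefactor in the mixing estimate. -/
  C : ℝ
  /-- The rate in the mixing estimate. -/
  M : ℝ
  C_pos : 0 < C
  M_pos : 0 < M
  mixing : ∀ x ∈ region (Iic (-1)), ∀ y ∈ region (Ici 0), ∀ n : ℕ, 0 < n →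
    ‖state (x * shift (n : ℤ) y) - state x * state y‖ ≤ C * Real.exp (-M * n) * ‖x‖ * ‖y‖

theorem expI_mem {A : Type*} [CStarAlgebra A] {S : StarSubalgebra ℂ A} (hS : IsClosed (S : Set A))
    {x : A} (hx : x ∈ S) : expI x ∈ S :=
  let _ : NormedAlgebra ℚ A := NormedAlgebra.restrictScalars ℚ ℂ A
  NormedSpace.exp_mem (R := ℂ) hS (S.smul_mem hx _)

namespace MixingChain

variable {A : Type*} [CStarAlgebra A] (S : MixingChain A)

theorem norm_shift_le (k : ℤ) (x : A) : ‖S.shift k x‖ ≤ ‖x‖ :=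
  NonUnitalStarAlgHom.norm_apply_le (S.shift k) x

theorem shift_mem_of_subset {Λ Λ' : Set ℤ} (k : ℤ) {x : A} (hx : x ∈ S.region Λ)
    (h : ∀ i ∈ Λ, i + k ∈ Λ') : S.shift k x ∈ S.region Λ' :=
  S.region_mono (image_subset_iff.2 h) (S.shift_mem k hx)

theorem mixing_of_gap {a b : ℤ} {g : ℕ} (hg : 0 < g) (hab : a + g < b) {x y : A}
    (hx : x ∈ S.region (Iic a)) (hy : y ∈ S.region (Ici b)) :
    ‖S.state (x * y) - S.state x * S.state y‖ ≤ S.C * Real.exp (-S.M * g) * ‖x‖ * ‖y‖ := by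
  -- Moving x to end at -1 and y to start at 0 leaves the distance n = b - a - 1, which is at least
  -- g.
  obtain ⟨n, hn⟩ : ∃ n : ℕ, (n : ℤ) = b - a - 1 := ⟨(b - a - 1).toNat, by omega⟩
  have h := S.mixing (S.shift (-(a + 1)) x)
    (S.shift_mem_of_subset _ hx fun i hi => by simp only [mem_Iic] at hi ⊢; omega)
    (S.shift (-b) y)
    (S.shift_mem_of_subset _ hy fun i hi => by simp only [mem_Ici] at hi ⊢; omega) n (by omega)
  rw [S.shift_shift, show (n : ℤ) + -b = -(a + 1) by omega, ← map_mul] at h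
  simp only [S.state_shift] at h
  have hCM := S.C_pos
  have hM := S.M_pos
  refine h.trans ?_
  gcongr ?_ * ?_ * ?_
  · gcongr S.C * Real.exp ?_
    have : (g : ℝ) ≤ n := by exact_mod_cast (show g ≤ n by omega)
    nlinarith
  · exact S.norm_shift_le _ _
  · exact S.norm_shift_le _ _

/-- A contraction which is a product of an observable on `(-∞,a]` and one on `[b,∞)`. -/
def IsSplit (a b : ℤ) (x : A) : Prop :=
  ∃ l ∈ S.region (Iic a), ∃ r ∈ S.region (Ici b), ‖l‖ ≤ 1 ∧ ‖r‖ ≤ 1 ∧ x = l * r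

theorem isSplit_one (a b : ℤ) : S.IsSplit a b 1 :=
  have h := norm_le_one_of_mem_unitary (one_mem (unitary A))
  ⟨1, one_mem _, 1, one_mem _, h, h, (one_mul 1).symm⟩

theorem commute_Iic_Ici {a b : ℤ} (hab : a < b) {x y : A} (hx : x ∈ S.region (Iic a))
    (hy : y ∈ S.region (Ici b)) : Commute x y :=
  S.commute_of_disjoint (Set.disjoint_left.2 fun i hi hi' => by
    simp only [mem_Iic, mem_Ici] at hi hi'; omega) hx hy

/-- The right part of the first factor commutes with the left part of the second, so left and right
parts can be collected separately. -/
theorem IsSplit.mul {a b : ℤ} (hab : a < b) {x y : A} (hx : S.IsSplit a b x)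
    (hy : S.IsSplit a b y) : S.IsSplit a b (x * y) := by
  obtain ⟨l, hl, r, hr, hl1, hr1, rfl⟩ := hx
  obtain ⟨l', hl', r', hr', hl1', hr1', rfl⟩ := hy
  refine ⟨l * l', mul_mem hl hl', r * r', mul_mem hr hr',
    (norm_mul_le _ _).trans (mul_le_one₀ hl1 (norm_nonneg _) hl1'),
    (norm_mul_le _ _).trans (mul_le_one₀ hr1 (norm_nonneg _) hr1'), ?_⟩
  have h := (S.commute_Iic_Ici hab hl' hr).eq
  calc l * r * (l' * r') = l * (r * l') * r' := by simp only [mul_assoc]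
    _ = l * l' * (r * r') := by rw [← h]; simp only [mul_assoc]

theorem isSplit_list_prod {a b : ℤ} (hab : a < b) {l : List A} (h : ∀ x ∈ l, S.IsSplit a b x) :
    S.IsSplit a b l.prod := by
  induction l with
  | nil => exact S.isSplit_one a b
  | cons x l ih =>
    simp only [List.forall_mem_cons] at h
    rw [List.prod_cons]
    exact h.1.mul S hab (ih h.2)

theorem isSplit_expI_add {a b : ℤ} (hab : a < b) {x y : A} (hx : x ∈ S.region (Iic a))
    (hy : y ∈ S.region (Ici b)) (hx' : IsSelfAdjoint x) (hy' : IsSelfAdjoint y) :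
    S.IsSplit a b (expI (x + y)) :=
  ⟨expI x, expI_mem (S.isClosed_region _) hx, expI y, expI_mem (S.isClosed_region _) hy,
    norm_expI_le hx', norm_expI_le hy', expI_add_of_commute (S.commute_Iic_Ici hab hx hy)⟩

/-- Factorization of an observable in a finite interval from the observables far away. -/
theorem mixing_of_isSplit {a b c e : ℤ} {g : ℕ} (hg : 0 < g) (hab : a + g < b) (hbc : b ≤ c)
    (hce : c + g < e) {x y : A} (hx : S.IsSplit a e x) (hy : y ∈ S.region (Icc b c)) :
    ‖S.state (x * y) - S.state x * S.state y‖ ≤ 3 * S.C * Real.exp (-S.M * g) * ‖y‖ := by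
  obtain ⟨l, hl, r, hr, hl1, hr1, rfl⟩ := hx
  have hbI : y ∈ S.region (Ici b) := S.region_mono Icc_subset_Ici_self hy
  have hbJ : y ∈ S.region (Iic c) := S.region_mono Icc_subset_Iic_self hy
  have hcr : Commute y r := S.commute_Iic_Ici (by omega) hbJ hr
  have hl' : l * y ∈ S.region (Iic c) :=
    mul_mem (S.region_mono (Iic_subset_Iic.2 (by omega)) hl) hbJ
  have h1 := S.mixing_of_gap hg hce hl' hr
  have h2 := S.mixing_of_gap hg hab hl hbI
  have h3 := S.mixing_of_gap hg (show a + g < e by omega) hl hr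
  have hE : 0 ≤ S.C * Real.exp (-S.M * g) := mul_nonneg S.C_pos.le (Real.exp_nonneg _)
  set E := S.C * Real.exp (-S.M * g)
  -- Three uses of mixing: detach r from ly, detach y from l, and reassemble l and r. This is the
  -- origin of the factor 3.
  have e : S.state (l * r * y) - S.state (l * r) * S.state y =
      (S.state (l * y * r) - S.state (l * y) * S.state r)
      + (S.state (l * y) - S.state l * S.state y) * S.state r
      - (S.state (l * r) - S.state l * S.state r) * S.state y := by
    rw [mul_assoc, ← hcr.eq, ← mul_assoc]; ring
  have hly : ‖l * y‖ ≤ ‖y‖ := (norm_mul_le _ _).trans (mul_le_of_le_one_left (norm_nonneg _) hl1)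
  have hsr : ‖S.state r‖ ≤ 1 := (S.norm_state_le r).trans hr1
  rw [e, show 3 * S.C * Real.exp (-S.M * g) * ‖y‖ = E * ‖y‖ + E * ‖y‖ + E * ‖y‖ by ring]
  refine (norm_sub_le _ _).trans (add_le_add ((norm_add_le _ _).trans (add_le_add ?_ ?_)) ?_)
  · refine h1.trans ((mul_le_of_le_one_right (by positivity) hr1).trans ?_)
    exact mul_le_mul_of_nonneg_left hly hE
  · rw [norm_mul]
    refine (mul_le_of_le_one_right (norm_nonneg _) hsr).trans (h2.trans ?_)
    exact mul_le_mul_of_nonneg_right (mul_le_of_le_one_right hE hl1) (norm_nonneg _)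
  · rw [norm_mul]
    refine mul_le_mul (h3.trans ?_) (S.norm_state_le y) (norm_nonneg _) hE
    exact (mul_le_of_le_one_right (by positivity) hr1).trans (mul_le_of_le_one_right hE hl1)

/-! ### Normalized sums of translates -/

/-- The normalization `(2N+1)^{-1/2}`. -/
def scale (N : ℕ) : ℝ := (Real.sqrt (2 * (N : ℝ) + 1))⁻¹

theorem scale_pos (N : ℕ) : 0 < scale N := by unfold scale; positivity

theorem scale_sq_mul (N : ℕ) : scale N * scale N * (2 * N + 1) = 1 := by
  have h : (0 : ℝ) < 2 * N + 1 := by positivity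
  unfold scale
  rw [← mul_inv, Real.mul_self_sqrt h.le, inv_mul_cancel₀ h.ne']

/-- The sum of the translates of `Q` by the sites in `s`, normalized by `(2N+1)^{-1/2}`. -/
def sumOn (N : ℕ) (s : Finset ℤ) (Q : A) : A := ((scale N : ℝ) : ℂ) • ∑ i ∈ s, S.shift i Q

theorem isSelfAdjoint_shift (k : ℤ) {x : A} (hx : IsSelfAdjoint x) : IsSelfAdjoint (S.shift k x) :=
  hx.map (S.shift k)

theorem isSelfAdjoint_sumOn (N : ℕ) (s : Finset ℤ) {Q : A} (hQ : IsSelfAdjoint Q) :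
    IsSelfAdjoint (S.sumOn N s Q) := by
  refine IsSelfAdjoint.smul (by simp [IsSelfAdjoint]) ?_
  exact isSelfAdjoint_sum _ fun i _ => S.isSelfAdjoint_shift i hQ

theorem norm_sumOn_le (N : ℕ) (s : Finset ℤ) (Q : A) :
    ‖S.sumOn N s Q‖ ≤ scale N * (s.card * ‖Q‖) := by
  rw [sumOn, norm_smul, Complex.norm_real, Real.norm_of_nonneg (scale_pos N).le]
  refine mul_le_mul_of_nonneg_left ?_ (scale_pos N).le
  refine (norm_sum_le _ _).trans ((Finset.sum_le_card_nsmul _ _ _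
    fun i _ => S.norm_shift_le i Q).trans_eq (nsmul_eq_mul _ _))

theorem sumOn_mem {Λ : Set ℤ} {m : ℕ} (N : ℕ) (s : Finset ℤ) {Q : A}
    (hQ : Q ∈ S.region (Icc (-(m : ℤ)) m)) (h : ∀ i ∈ s, Icc (i - m) (i + m) ⊆ Λ) :
    S.sumOn N s Q ∈ S.region Λ := by
  refine (S.region Λ).smul_mem (sum_mem fun i hi => ?_) _
  refine S.shift_mem_of_subset i hQ fun k hk => h i hi ?_
  simp only [mem_Icc] at hk ⊢
  omega

theorem sumOn_add_sumOn {N : ℕ} {s t u : Finset ℤ} (h : Disjoint s t) (hu : s ∪ t = u) (Q : A) :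
    S.sumOn N s Q + S.sumOn N t Q = S.sumOn N u Q := by
  rw [sumOn, sumOn, sumOn, ← smul_add, ← Finset.sum_union h, hu]

/-- The sites of `[-N,N]`. -/
abbrev window (N : ℕ) : Finset ℤ := Finset.Icc (-(N : ℤ)) N

theorem card_window (N : ℕ) : ((window N).card : ℝ) = 2 * N + 1 := by
  have : (window N).card = 2 * N + 1 := by simp; omega
  rw [this]; push_cast; ring

/-- The sites of `[-N,N]` at distance at most `r` from `j`. -/
def near (N : ℕ) (j : ℤ) (r : ℕ) : Finset ℤ := (window N).filter fun i => |i - j| ≤ r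

/-- The sites of `[-N,N]` at distance more than `r` from `j`. -/
def far (N : ℕ) (j : ℤ) (r : ℕ) : Finset ℤ := (window N).filter fun i => ¬ |i - j| ≤ r

theorem card_near_le (N : ℕ) (j : ℤ) (r : ℕ) : (near N j r).card ≤ 2 * r + 1 := by
  have h : near N j r ⊆ Finset.Icc (j - r) (j + r) := fun i hi => by
    simp only [near, Finset.mem_filter, abs_le] at hi
    simp only [Finset.mem_Icc]
    omega
  refine (Finset.card_le_card h).trans ?_
  simp
  omega

theorem sumOn_far_add_near (N : ℕ) (j : ℤ) (r : ℕ) (Q : A) :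
    S.sumOn N (far N j r) Q + S.sumOn N (near N j r) Q = S.sumOn N (window N) Q :=
  S.sumOn_add_sumOn (Finset.disjoint_filter_filter_not _ _ _).symm
    (by rw [Finset.union_comm]; exact Finset.filter_union_filter_not_eq _ _) Q

/-- Without the sites near j the sum falls into a left and a right part, which commute; the supports
reach m sites further towards j than the sites themselves. -/
theorem isSplit_expI_sumOn_far (N : ℕ) (j : ℤ) {m r : ℕ} (hr : m ≤ r) {Q : A}
    (hQ : Q ∈ S.region (Icc (-(m : ℤ)) m)) (hsa : IsSelfAdjoint Q) :
    S.IsSplit (j - r - 1 + m) (j + r + 1 - m) (expI (S.sumOn N (far N j r) Q)) := by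
  have h1 : Disjoint ((far N j r).filter (· < j)) ((far N j r).filter fun i => ¬ i < j) :=
    Finset.disjoint_filter_filter_not _ _ _
  rw [← S.sumOn_add_sumOn h1 (Finset.filter_union_filter_not_eq _ _) Q]
  refine S.isSplit_expI_add (by omega) ?_ ?_ (S.isSelfAdjoint_sumOn _ _ hsa)
    (S.isSelfAdjoint_sumOn _ _ hsa)
  · refine S.sumOn_mem N _ hQ fun i hi k hk => ?_
    simp only [far, Finset.mem_filter, abs_le] at hi
    simp only [mem_Icc, mem_Iic] at hk ⊢
    omega
  · refine S.sumOn_mem N _ hQ fun i hi k hk => ?_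
    simp only [far, Finset.mem_filter, abs_le] at hi
    simp only [mem_Icc, mem_Ici] at hk ⊢
    omega

theorem norm_commutator_le (x y : A) : ‖x * y - y * x‖ ≤ 2 * (‖x‖ * ‖y‖) := by
  refine (norm_sub_le _ _).trans ?_
  have h1 := norm_mul_le x y
  have h2 := norm_mul_le y x
  linarith [mul_comm ‖x‖ ‖y‖]

/-- Translates by i and k commute unless |i - k| ≤ 2m, so each i in s has at most 4m + 1 partners.
The bound depends on the size of s alone, and t may be the whole window. -/
theorem norm_commutator_sumOn_le (N m : ℕ) (s t : Finset ℤ) {Q R : A} {B : ℝ}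
    (hQ : Q ∈ S.region (Icc (-(m : ℤ)) m)) (hR : R ∈ S.region (Icc (-(m : ℤ)) m))
    (hQB : ‖Q‖ ≤ B) (hRB : ‖R‖ ≤ B) :
    ‖S.sumOn N s Q * S.sumOn N t R - S.sumOn N t R * S.sumOn N s Q‖
      ≤ scale N ^ 2 * (s.card * ((4 * m + 1) * (2 * B ^ 2))) := by
  have hB : 0 ≤ B := (norm_nonneg _).trans hQB
  have e : S.sumOn N s Q * S.sumOn N t R - S.sumOn N t R * S.sumOn N s Q =
      (((scale N) ^ 2 : ℝ) : ℂ) • ∑ i ∈ s, ∑ k ∈ t,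
        (S.shift i Q * S.shift k R - S.shift k R * S.shift i Q) := by
    simp only [sumOn, smul_mul_smul_comm, Finset.sum_mul_sum, Finset.sum_sub_distrib, smul_sub]
    rw [Finset.sum_comm (s := t)]
    push_cast
    rw [sq]
  rw [e, norm_smul, Complex.norm_real, Real.norm_of_nonneg (by positivity)]
  refine mul_le_mul_of_nonneg_left ?_ (by positivity)
  refine (norm_sum_le _ _).trans ((Finset.sum_le_card_nsmul _ _ _ fun i _ => ?_).trans_eq
    (nsmul_eq_mul _ _))
  have hterm : ∀ k ∈ t, ‖S.shift i Q * S.shift k R - S.shift k R * S.shift i Q‖ ≤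
      if k ∈ Finset.Icc (i - 2 * m) (i + 2 * m) then 2 * B ^ 2 else 0 := by
    intro k _
    split_ifs with h
    · refine (norm_commutator_le _ _).trans ?_
      rw [sq]
      gcongr
      · exact (S.norm_shift_le _ _).trans hQB
      · exact (S.norm_shift_le _ _).trans hRB
    · have : Commute (S.shift i Q) (S.shift k R) := by
        refine S.commute_of_disjoint ?_ (S.shift_mem i hQ) (S.shift_mem k hR)
        rw [Set.disjoint_left]
        rintro _ ⟨u, hu, rfl⟩ ⟨v, hv, hv'⟩
        simp only [mem_Icc, Finset.mem_Icc] at hu hv hv' h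
        omega
      rw [this.eq, sub_self, norm_zero]
  refine (norm_sum_le _ _).trans ((Finset.sum_le_sum hterm).trans ?_)
  rw [← Finset.sum_filter, Finset.sum_const, nsmul_eq_mul]
  refine mul_le_mul_of_nonneg_right ?_ (by positivity)
  have hc : (t.filter fun k => k ∈ Finset.Icc (i - 2 * (m : ℤ)) (i + 2 * m)).card ≤ 4 * m + 1 := by
    refine (Finset.card_le_card (t := Finset.Icc (i - 2 * (m : ℤ)) (i + 2 * m)) fun k hk => ?_).trans
      ?_
    · exact (Finset.mem_filter.1 hk).2
    · simp
      omega
  exact_mod_cast hc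

end MixingChain


namespace MixingChain

variable {A : Type*} [CStarAlgebra A] (S : MixingChain A)

/-! ### The Stein identity -/

theorem shift_mem_Icc {m : ℕ} (j : ℤ) {Q : A} (hQ : Q ∈ S.region (Icc (-(m : ℤ)) m)) :
    S.shift j Q ∈ S.region (Icc (j - m) (j + m)) :=
  S.shift_mem_of_subset j hQ fun i hi => by simp only [mem_Icc] at hi ⊢; omega

/-- Sites more than 3m apart leave a gap exceeding m between supports of radius m. If i lies to the
right of j, the two factors are first exchanged, since they commute. -/
theorem norm_state_mul_le_of_far {i j : ℤ} {m : ℕ} (hm : 0 < m) (hij : 3 * (m : ℤ) < |i - j|)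
    {Q R : A} {B : ℝ} (hQ : Q ∈ S.region (Icc (-(m : ℤ)) m))
    (hR : R ∈ S.region (Icc (-(m : ℤ)) m)) (hQB : ‖Q‖ ≤ B) (hRB : ‖R‖ ≤ B) :
    ‖S.state (S.shift i Q * S.shift j R) - S.state Q * S.state R‖
      ≤ S.C * Real.exp (-S.M * m) * B ^ 2 := by
  have hB : 0 ≤ B := (norm_nonneg _).trans hQB
  have hQ' := S.shift_mem_Icc i hQ
  have hR' := S.shift_mem_Icc j hR
  have hE : 0 ≤ S.C * Real.exp (-S.M * m) := mul_nonneg S.C_pos.le (Real.exp_nonneg _)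
  rw [← S.state_shift i Q, ← S.state_shift j R]
  have hQB' := (S.norm_shift_le i Q).trans hQB
  have hRB' := (S.norm_shift_le j R).trans hRB
  rw [sq, ← mul_assoc]
  rcases lt_abs.1 hij with h | h
  · rw [(S.commute_of_disjoint (Set.disjoint_left.2 fun k hk hk' => by
      simp only [mem_Icc] at hk hk'; omega) hQ' hR').eq, mul_comm (S.state _)]
    refine (S.mixing_of_gap hm (by omega) (S.region_mono Icc_subset_Iic_self hR')
      (S.region_mono Icc_subset_Ici_self hQ')).trans ?_
    gcongr
  · refine (S.mixing_of_gap hm (by omega) (S.region_mono Icc_subset_Iic_self hQ')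
      (S.region_mono Icc_subset_Ici_self hR')).trans ?_
    gcongr

theorem norm_state_sumOn_far_mul_le (N : ℕ) (j : ℤ) {m : ℕ} (hm : 0 < m)
    {Q R : A} {B : ℝ} (hQ : Q ∈ S.region (Icc (-(m : ℤ)) m))
    (hR : R ∈ S.region (Icc (-(m : ℤ)) m)) (hQB : ‖Q‖ ≤ B) (hRB : ‖R‖ ≤ B)
    (hR0 : S.state R = 0) :
    ‖S.state (S.sumOn N (far N j (3 * m)) Q * S.shift j R)‖
      ≤ scale N * ((2 * N + 1) * (S.C * Real.exp (-S.M * m) * B ^ 2)) := by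
  have hE : 0 ≤ S.C * Real.exp (-S.M * m) := mul_nonneg S.C_pos.le (Real.exp_nonneg _)
  rw [sumOn, smul_mul_assoc, map_smul, norm_smul, Complex.norm_real,
    Real.norm_of_nonneg (scale_pos N).le, Finset.sum_mul, map_sum]
  refine mul_le_mul_of_nonneg_left ?_ (scale_pos N).le
  refine (norm_sum_le _ _).trans ((Finset.sum_le_card_nsmul _ _
    (S.C * Real.exp (-S.M * m) * B ^ 2) fun i hi => ?_).trans ?_)
  · simp only [far, Finset.mem_filter, not_le] at hi
    have h := S.norm_state_mul_le_of_far hm (i := i) (j := j)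
      (by have := hi.2; push_cast at this; exact this) hQ hR hQB hRB
    rwa [hR0, mul_zero, sub_zero] at h
  · rw [nsmul_eq_mul, ← card_window]
    refine mul_le_mul_of_nonneg_right ?_ (by positivity)
    exact_mod_cast Finset.card_le_card (Finset.filter_subset _ _)

theorem state_list_sum_mul {ι : Type*} (l : List ι) (f : ι → A) (y : A) :
    S.state ((l.map f).sum * y) = (l.map fun i => S.state (f i * y)).sum := by
  induction l with
  | nil => simp
  | cons a l ih => simp [add_mul, ih]

/-- The Stein identity at a single site. -/
theorem stein_site {N m : ℕ} (hm : 0 < m) (j : ℤ) {B : ℝ} (hB : scale N * (13 * m * B) ≤ 1)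
    (l : List A) (hl : ∀ Q ∈ l, Q ∈ S.region (Icc (-(m : ℤ)) m)) (hsa : ∀ Q ∈ l, IsSelfAdjoint Q)
    (hlB : ∀ Q ∈ l, ‖Q‖ ≤ B) {R : A} (hR : R ∈ S.region (Icc (-(m : ℤ)) m)) (hRB : ‖R‖ ≤ B)
    (hR0 : S.state R = 0) :
    ‖S.state ((l.map fun Q => expI (S.sumOn N (window N) Q)).prod * S.shift j R)
        - Complex.I * (S.state (l.map fun Q => expI (S.sumOn N (window N) Q)).prod
          * S.state ((l.map fun Q => S.sumOn N (window N) Q).sum * S.shift j R))‖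
      ≤ (299 * 4 ^ l.length * B ^ 3 + 507 * l.length ^ 2 * B ^ 3) * (scale N ^ 2 * m ^ 2)
        + (3 * S.C * B + 3 * S.C * l.length * B) * Real.exp (-S.M * m)
        + l.length * S.C * B ^ 2 * (scale N * (2 * N + 1) * Real.exp (-S.M * m)) := by
  have hB0 : 0 ≤ B := (norm_nonneg _).trans hRB
  have hw := (scale_pos N).le
  have hm1 : (1 : ℝ) ≤ m := by exact_mod_cast hm
  set k : ℝ := (l.length : ℝ) with hk
  have hk0 : 0 ≤ k := by positivity
  set e : ℝ := Real.exp (-S.M * m) with he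
  have he0 : 0 ≤ e := Real.exp_nonneg _
  have hC := S.C_pos.le
  set δ : ℝ := scale N * (13 * m * B) with hδ
  have hδ0 : 0 ≤ δ := by positivity
  set κ : ℝ := scale N ^ 2 * (130 * m ^ 2 * B ^ 2) with hκ
  have hκ0 : 0 ≤ κ := by positivity
  set Y : A := S.shift j R with hY
  have hYB : ‖Y‖ ≤ B := (S.norm_shift_le j R).trans hRB
  have hYm : Y ∈ S.region (Icc (j - m) (j + m)) := S.shift_mem_Icc j hR
  have hY0 : S.state Y = 0 := (S.state_shift j R).trans hR0
  have hFsa : ∀ r, ∀ Q ∈ l, IsSelfAdjoint (S.sumOn N (far N j r) Q) :=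
    fun r Q hQ => S.isSelfAdjoint_sumOn _ _ (hsa Q hQ)
  have hGsa : ∀ r, ∀ Q ∈ l, IsSelfAdjoint (S.sumOn N (near N j r) Q) :=
    fun r Q hQ => S.isSelfAdjoint_sumOn _ _ (hsa Q hQ)
  have hXsa : ∀ Q ∈ l, IsSelfAdjoint (S.sumOn N (window N) Q) :=
    fun Q hQ => S.isSelfAdjoint_sumOn _ _ (hsa Q hQ)
  -- The two radii used are 3m and 6m, and 2·6m + 1 ≤ 13m.
  have hcard : ∀ r ≤ 6 * m, ((near N j r).card : ℝ) ≤ 13 * m := fun r hr => by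
    have := card_near_le N j r
    exact_mod_cast (show (near N j r).card ≤ 13 * m by omega)
  have hGδ : ∀ r ≤ 6 * m, ∀ Q ∈ l, ‖S.sumOn N (near N j r) Q‖ ≤ δ := fun r hr Q hQ => by
    refine (S.norm_sumOn_le N _ Q).trans (mul_le_mul_of_nonneg_left ?_ hw)
    exact mul_le_mul (hcard r hr) (hlB Q hQ) (norm_nonneg _) (by positivity)
  have hFX : ∀ r ≤ 6 * m, ∀ Q ∈ l,
      ‖S.sumOn N (far N j r) Q - S.sumOn N (window N) Q‖ ≤ δ := fun r hr Q hQ => by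
    rw [← S.sumOn_far_add_near N j r Q, sub_add_cancel_left, norm_neg]
    exact hGδ r hr Q hQ
  have hexp := norm_list_prod_expI_add_sub_le l (F := S.sumOn N (far N j (3 * m)))
    (G := S.sumOn N (near N j (3 * m))) hδ0 hB hκ0 (hFsa _) (hGsa _) (hGδ _ (by omega))
    (fun Q hQ Q' hQ' => by
      refine (S.norm_commutator_sumOn_le N m _ _ (hl Q hQ) (hl Q' hQ') (hlB Q hQ)
        (hlB Q' hQ')).trans (mul_le_mul_of_nonneg_left ?_ (by positivity))
      -- At most 13m near sites, each with at most 4m + 1 ≤ 5m noncommuting partners.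
      calc _ ≤ (13 * m : ℝ) * ((5 * m) * (2 * B ^ 2)) := by
            have h5 : (4 * m + 1 : ℝ) ≤ 5 * m := by linarith
            exact mul_le_mul (hcard _ (by omega)) (mul_le_mul_of_nonneg_right h5 (by positivity))
              (by positivity) (by positivity)
        _ = _ := by ring)
  simp only [S.sumOn_far_add_near] at hexp
  have h3 := norm_list_prod_expI_sub_le l (hFsa _) hXsa (hFX (3 * m) (by omega))
  have h6 := norm_list_prod_expI_sub_le l (hFsa _) hXsa (hFX (6 * m) (by omega))
  have hsplit : ∀ r ≥ m, S.IsSplit (j - r - 1 + m) (j + r + 1 - m)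
      (l.map fun Q => expI (S.sumOn N (far N j r) Q)).prod := fun r hr => by
    refine S.isSplit_list_prod (by omega) fun x hx => ?_
    obtain ⟨Q, hQ, rfl⟩ := List.mem_map.1 hx
    exact S.isSplit_expI_sumOn_far N j hr (hl Q hQ) (hsa Q hQ)
  -- Radius 3m keeps a gap exceeding m around the support [j-m, j+m] of Y. The product of the near
  -- parts with Y lives in [j-4m, j+4m], which is why the larger radius 6m is needed for it.
  have hs3 := hsplit (3 * m) (by omega)
  have hs6 := hsplit (6 * m) (by omega)
  have hΓ := norm_list_sum_map_le l (hGδ (3 * m) (by omega))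
  have hΓm : (l.map (S.sumOn N (near N j (3 * m)))).sum * Y
      ∈ S.region (Icc (j - 4 * m) (j + 4 * m)) := by
    refine mul_mem (list_sum_mem fun x hx => ?_) ?_
    · obtain ⟨Q, hQ, rfl⟩ := List.mem_map.1 hx
      refine S.sumOn_mem N _ (hl Q hQ) fun i hi k hk => ?_
      simp only [near, Finset.mem_filter, abs_le] at hi
      simp only [mem_Icc] at hk ⊢
      omega
    · exact S.region_mono (Icc_subset_Icc (by omega) (by omega)) hYm
  have hsum : (l.map fun Q => S.sumOn N (window N) Q).sum
      = (l.map (S.sumOn N (far N j (3 * m)))).sum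
        + (l.map (S.sumOn N (near N j (3 * m)))).sum := by
    rw [← List.sum_map_add]
    simp only [S.sumOn_far_add_near]
  have hfar : ‖S.state ((l.map (S.sumOn N (far N j (3 * m)))).sum * Y)‖
      ≤ k * (scale N * ((2 * N + 1) * (S.C * e * B ^ 2))) := by
    rw [S.state_list_sum_mul]
    exact norm_list_sum_map_le l fun Q hQ =>
      S.norm_state_sumOn_far_mul_le N j hm (hl Q hQ) hR (hlB Q hQ) hRB hR0
  rw [hsum]
  set P := (l.map fun Q => expI (S.sumOn N (window N) Q)).prod
  set P3 := (l.map fun Q => expI (S.sumOn N (far N j (3 * m)) Q)).prod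
  set P6 := (l.map fun Q => expI (S.sumOn N (far N j (6 * m)) Q)).prod
  set Γ := (l.map (S.sumOn N (near N j (3 * m)))).sum
  set Φ := (l.map (S.sumOn N (far N j (3 * m)))).sum
  have hP : ‖P‖ ≤ 1 := norm_list_prod_expI_le l hXsa
  have hm3 := S.mixing_of_isSplit hm (by push_cast; omega) (by omega) (by push_cast; omega) hs3 hYm
  have hm6 := S.mixing_of_isSplit hm (by push_cast; omega) (by omega) (by push_cast; omega) hs6 hΓm
  have hΓY : ‖Γ * Y‖ ≤ k * δ * B := (norm_mul_le _ _).trans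
    (mul_le_mul hΓ hYB (norm_nonneg _) (by positivity))
  rw [hY0, mul_zero, sub_zero] at hm3
  have h36 : ‖P3 - P6‖ ≤ 2 * (k * δ) := by
    have : P3 - P6 = (P3 - P) - (P6 - P) := by abel
    rw [this]
    refine (norm_sub_le _ _).trans ?_
    linarith
  -- Expand P as P3(1 + iΓ). The zeroth-order term decouples and is small because Y is centered. In
  -- the first-order term P3 is replaced by P6, then P6 is decoupled from ΓY, then replaced by P;
  -- finally ΦY is added, whose expectation is small by mixing.
  have dec : S.state (P * Y) - Complex.I * (S.state P * S.state ((Φ + Γ) * Y)) =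
      S.state ((P - P3 * (1 + Complex.I • Γ)) * Y) + S.state (P3 * Y)
      + Complex.I * (S.state ((P3 - P6) * (Γ * Y))
        + (S.state (P6 * (Γ * Y)) - S.state P6 * S.state (Γ * Y))
        + S.state (P6 - P) * S.state (Γ * Y) - S.state P * S.state (Φ * Y)) := by
    simp only [sub_mul, mul_add, add_mul, mul_one, map_sub, map_add, mul_smul_comm, smul_mul_assoc,
      map_smul, smul_eq_mul, mul_assoc]
    ring
  have b1 : ‖S.state ((P - P3 * (1 + Complex.I • Γ)) * Y)‖ ≤ 4 ^ l.length * (κ + δ ^ 2) * B :=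
    (S.norm_state_le _).trans ((norm_mul_le _ _).trans
      (mul_le_mul hexp hYB (norm_nonneg _) (by positivity)))
  have b2 : ‖S.state (P3 * Y)‖ ≤ 3 * S.C * e * B := hm3.trans
    (mul_le_mul_of_nonneg_left hYB (by positivity))
  have b3 : ‖S.state ((P3 - P6) * (Γ * Y))‖ ≤ 2 * (k * δ) * (k * δ * B) :=
    (S.norm_state_le _).trans ((norm_mul_le _ _).trans
      (mul_le_mul h36 hΓY (norm_nonneg _) (by positivity)))
  have b4 : ‖S.state (P6 * (Γ * Y)) - S.state P6 * S.state (Γ * Y)‖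
      ≤ 3 * S.C * e * (k * 1 * B) := by
    refine hm6.trans (mul_le_mul_of_nonneg_left (hΓY.trans ?_) (by positivity))
    gcongr
  have b5 : ‖S.state (P6 - P) * S.state (Γ * Y)‖ ≤ k * δ * (k * δ * B) := by
    rw [norm_mul]
    exact mul_le_mul ((S.norm_state_le _).trans h6) ((S.norm_state_le _).trans hΓY)
      (norm_nonneg _) (by positivity)
  have b6 : ‖S.state P * S.state (Φ * Y)‖ ≤
      k * (scale N * ((2 * N + 1) * (S.C * e * B ^ 2))) := by
    rw [norm_mul]
    exact (mul_le_of_le_one_left (norm_nonneg _) ((S.norm_state_le _).trans hP)).trans hfar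
  rw [dec]
  refine ((norm_add_le _ _).trans (add_le_add ((norm_add_le _ _).trans (add_le_add b1 b2))
    ((norm_mul_le _ _).trans (mul_le_mul_of_nonneg_left ((norm_sub_le _ _).trans
      (add_le_add ((norm_add_le _ _).trans (add_le_add ((norm_add_le _ _).trans
        (add_le_add b3 b4)) b5)) b6)) (norm_nonneg _))))).trans_eq ?_
  rw [Complex.norm_I, hδ, hκ]
  ring

/-- The error in the Stein identity for `k` observables bounded by `B`, supported in `[-m,m]`. -/
def steinError (N m k : ℕ) (B : ℝ) : ℝ :=
  scale N * (2 * N + 1) *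
    ((299 * 4 ^ k * B ^ 3 + 507 * k ^ 2 * B ^ 3) * (scale N ^ 2 * m ^ 2)
        + (3 * S.C * B + 3 * S.C * k * B) * Real.exp (-S.M * m)
        + k * S.C * B ^ 2 * (scale N * (2 * N + 1) * Real.exp (-S.M * m)))

/-- The Stein identity. -/
theorem stein {N m : ℕ} (hm : 0 < m) {B : ℝ} (hB : scale N * (13 * m * B) ≤ 1)
    (l : List A) (hl : ∀ Q ∈ l, Q ∈ S.region (Icc (-(m : ℤ)) m)) (hsa : ∀ Q ∈ l, IsSelfAdjoint Q)
    (hlB : ∀ Q ∈ l, ‖Q‖ ≤ B) {R : A} (hR : R ∈ S.region (Icc (-(m : ℤ)) m)) (hRB : ‖R‖ ≤ B)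
    (hR0 : S.state R = 0) :
    ‖S.state ((l.map fun Q => expI (S.sumOn N (window N) Q)).prod * S.sumOn N (window N) R)
        - Complex.I * (S.state (l.map fun Q => expI (S.sumOn N (window N) Q)).prod
          * S.state ((l.map fun Q => S.sumOn N (window N) Q).sum * S.sumOn N (window N) R))‖
      ≤ S.steinError N m l.length B := by
  have hX : S.sumOn N (window N) R = ((scale N : ℝ) : ℂ) • ∑ j ∈ window N, S.shift j R := rfl
  rw [hX]
  simp only [mul_smul_comm, Finset.mul_sum, map_smul, map_sum, smul_eq_mul]
  have e : ∀ (a b c : ℂ) (f g : ℤ → ℂ), ∑ j ∈ window N, a * f j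
      - ∑ j ∈ window N, b * (c * (a * g j)) = a * ∑ j ∈ window N, (f j - b * (c * g j)) := by
    intros a b c f g
    rw [← Finset.sum_sub_distrib, Finset.mul_sum]
    exact Finset.sum_congr rfl fun j _ => by ring
  rw [e, norm_mul, Complex.norm_real, Real.norm_of_nonneg (scale_pos N).le, steinError, mul_assoc]
  refine mul_le_mul_of_nonneg_left ?_ (scale_pos N).le
  rw [← card_window, ← nsmul_eq_mul]
  refine (norm_sum_le _ _).trans (Finset.sum_le_card_nsmul _ _ _ fun j _ => ?_)
  rw [card_window]
  exact S.stein_site hm j hB l hl hsa hlB hR hRB hR0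

end MixingChain

/-- A perturbed linear differential equation with Gaussian solution. -/
theorem norm_sub_exp_le_of_deriv {h h' : ℝ → ℂ} {a b : ℂ} {ε : ℝ}
    (hd : ∀ s, HasDerivAt h (h' s) s)
    (hε : ∀ s ∈ Ico (0 : ℝ) 1, ‖h' s + (a + s * b) * h s‖ ≤ ε) :
    ‖h 1 - h 0 * Complex.exp (-(a + b / 2))‖ ≤ ε * Real.exp (2 * (‖a‖ + ‖b‖)) := by
  have hε0 : 0 ≤ ε := (norm_nonneg _).trans (hε 0 (by simp))
  -- Integrating factor for h' = -(a + sb)h. Bounding it and its inverse at s = 1 gives the two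
  -- factors exp(‖a‖ + ‖b‖) of the error.
  have hexp : ∀ s : ℝ, HasDerivAt (fun s : ℝ => Complex.exp (a * s + b * s ^ 2 / 2))
      (Complex.exp (a * s + b * s ^ 2 / 2) * (a + s * b)) s := by
    intro s
    have h1 : HasDerivAt (fun z : ℂ => Complex.exp (a * z + b * z ^ 2 / 2))
        (Complex.exp (a * s + b * s ^ 2 / 2) * (a + s * b)) (s : ℂ) := by
      refine HasDerivAt.cexp ?_
      refine (((hasDerivAt_id (s : ℂ)).const_mul a).add
        ((((hasDerivAt_id (s : ℂ)).pow 2).const_mul b).div_const 2)).congr_deriv ?_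
      simp
      ring
    exact h1.comp_ofReal
  have hnorm : ∀ s ∈ Icc (0 : ℝ) 1, ‖Complex.exp (a * s + b * s ^ 2 / 2)‖
      ≤ Real.exp (‖a‖ + ‖b‖) := by
    intro s hs
    refine (Complex.norm_exp_le_exp_norm _).trans (Real.exp_le_exp.2 ?_)
    refine (norm_add_le _ _).trans (add_le_add ?_ ?_)
    · rw [norm_mul, Complex.norm_real, Real.norm_of_nonneg hs.1]
      exact mul_le_of_le_one_right (norm_nonneg _) hs.2
    · rw [norm_div, norm_mul, norm_pow, Complex.norm_real, Real.norm_of_nonneg hs.1]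
      have : s ^ 2 ≤ 1 := pow_le_one₀ hs.1 hs.2
      have := mul_le_of_le_one_right (norm_nonneg b) this
      have h2 : ‖(2 : ℂ)‖ = 2 := by simp
      rw [h2]
      linarith [norm_nonneg b]
  have hmv := norm_image_sub_le_of_norm_deriv_le_segment_01' (C := ε * Real.exp (‖a‖ + ‖b‖))
    (f := fun s : ℝ => h s * Complex.exp (a * s + b * s ^ 2 / 2))
    (fun s _ => ((hd s).mul (hexp s)).hasDerivWithinAt) (fun s hs => by
      have e : h' s * Complex.exp (a * s + b * s ^ 2 / 2)
          + h s * (Complex.exp (a * s + b * s ^ 2 / 2) * (a + s * b))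
          = (h' s + (a + s * b) * h s) * Complex.exp (a * s + b * s ^ 2 / 2) := by ring
      rw [e, norm_mul]
      exact mul_le_mul (hε s hs) (hnorm s ⟨hs.1, hs.2.le⟩) (norm_nonneg _) hε0)
  have h1 : h 1 - h 0 * Complex.exp (-(a + b / 2)) =
      (h 1 * Complex.exp (a * (1 : ℝ) + b * (1 : ℝ) ^ 2 / 2)
        - h 0 * Complex.exp (a * (0 : ℝ) + b * (0 : ℝ) ^ 2 / 2)) * Complex.exp (-(a + b / 2)) := by
    rw [sub_mul, mul_assoc, ← Complex.exp_add]
    simp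
  rw [h1, norm_mul, two_mul, Real.exp_add, ← mul_assoc]
  refine mul_le_mul hmv ?_ (norm_nonneg _) (by positivity)
  refine (Complex.norm_exp_le_exp_norm _).trans (Real.exp_le_exp.2 ?_)
  rw [norm_neg]
  refine (norm_add_le _ _).trans (add_le_add_right ?_ _)
  rw [norm_div]
  have h2 : ‖(2 : ℂ)‖ = 2 := by simp
  rw [h2]
  linarith [norm_nonneg b]

/-! ### From the Stein identity to Gaussian factors -/

namespace MixingChain

variable {A : Type*} [CStarAlgebra A] (S : MixingChain A)

/-- The state as a continuous linear functional. -/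
def stateCLM : A →L[ℂ] ℂ := S.state.mkContinuous 1 fun x => by simpa using S.norm_state_le x

theorem stateCLM_apply (x : A) : S.stateCLM x = S.state x := rfl

theorem sumOn_real_smul (N : ℕ) (s : Finset ℤ) (t : ℝ) (Q : A) :
    S.sumOn N s (t • Q) = t • S.sumOn N s Q := by
  have h : ∀ x : A, t • x = (t : ℂ) • x := fun x => (Complex.coe_smul t x).symm
  simp only [sumOn, h, map_smul, ← Finset.smul_sum, smul_comm (t : ℂ)]

/-- One more factor in a product of exponentials contributes a Gaussian factor. -/
theorem norm_state_mul_expI_sub_le {N m : ℕ} (hm : 0 < m) {B : ℝ}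
    (hB : scale N * (13 * m * B) ≤ 1)
    (l : List A) (hl : ∀ Q ∈ l, Q ∈ S.region (Icc (-(m : ℤ)) m)) (hsa : ∀ Q ∈ l, IsSelfAdjoint Q)
    (hlB : ∀ Q ∈ l, ‖Q‖ ≤ B) {R : A} (hR : R ∈ S.region (Icc (-(m : ℤ)) m))
    (hRsa : IsSelfAdjoint R) (hRB : ‖R‖ ≤ B) (hR0 : S.state R = 0) {a b : ℂ}
    (ha : a = S.state ((l.map fun Q => S.sumOn N (window N) Q).sum * S.sumOn N (window N) R))
    (hb : b = S.state (S.sumOn N (window N) R * S.sumOn N (window N) R)) :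
    ‖S.state ((l.map fun Q => expI (S.sumOn N (window N) Q)).prod * expI (S.sumOn N (window N) R))
        - S.state (l.map fun Q => expI (S.sumOn N (window N) Q)).prod
          * Complex.exp (-(a + b / 2))‖
      ≤ S.steinError N m (l.length + 1) B * Real.exp (2 * (‖a‖ + ‖b‖)) := by
  set P := (l.map fun Q => expI (S.sumOn N (window N) Q)).prod
  set X := S.sumOn N (window N) R
  have hd : ∀ s : ℝ, HasDerivAt (fun s : ℝ => S.stateCLM (P * expI (s • X)))
      (S.stateCLM (P * (expI (s • X) * (Complex.I • X)))) s := fun s =>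
    (S.stateCLM.restrictScalars ℝ).hasFDerivAt.comp_hasDerivAt s ((hasDerivAt_expI X s).const_mul P)
  have := norm_sub_exp_le_of_deriv (a := a) (b := b) hd (ε := S.steinError N m (l.length + 1) B)
    (fun s hs => by
      -- With s • R appended to the list, the covariance with X becomes a + sb, so the Stein
      -- identity is the perturbed differential equation for s ↦ φ(P exp(isX)). The extra factor i
      -- from the derivative turns i(a + sb) into -(a + sb).
      have hst := S.stein hm hB (l ++ [s • R]) (R := R)
        (by
          simp only [List.mem_append, List.mem_singleton]
          rintro Q (hQ | rfl)
          · exact hl Q hQ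
          · exact (Complex.coe_smul s R) ▸ (S.region _).smul_mem hR _)
        (by
          simp only [List.mem_append, List.mem_singleton]
          rintro Q (hQ | rfl)
          · exact hsa Q hQ
          · exact isSelfAdjoint_real_smul hRsa s)
        (by
          simp only [List.mem_append, List.mem_singleton]
          rintro Q (hQ | rfl)
          · exact hlB Q hQ
          · rw [norm_smul, Real.norm_of_nonneg hs.1]
            exact (mul_le_of_le_one_left (norm_nonneg _) hs.2.le).trans hRB) hR hRB hR0
      simp only [List.map_append, List.prod_append, List.sum_append, List.map_cons, List.map_nil,
        List.prod_singleton, List.sum_singleton, sumOn_real_smul, List.length_append,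
        List.length_singleton, add_mul, map_add, smul_mul_assoc] at hst
      rw [← Complex.coe_smul s (X * X), map_smul, ← ha, ← hb, smul_eq_mul] at hst
      refine le_trans (le_of_eq ?_) hst
      rw [← one_mul ‖S.state _ - _‖, ← Complex.norm_I, ← norm_mul]
      congr 1
      simp only [stateCLM_apply, mul_smul_comm, map_smul, smul_eq_mul, mul_sub, mul_assoc]
      linear_combination S.state (P * expI (s • X)) * (a + s * b) * Complex.I_mul_I)
  simpa [stateCLM_apply] using this

end MixingChain


namespace MixingChain

/-! ### The central limit theorem for arrays of local observables -/

/-- A slowly growing localization radius, `⌊N^{1/8}⌋`. -/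
def radius (N : ℕ) : ℕ := Nat.sqrt (Nat.sqrt (Nat.sqrt N))

theorem tendsto_natSqrt : Tendsto Nat.sqrt atTop atTop :=
  tendsto_atTop.2 fun b => (eventually_ge_atTop (b * b)).mono fun _ hN => Nat.le_sqrt.2 hN

theorem tendsto_radius : Tendsto radius atTop atTop :=
  tendsto_natSqrt.comp (tendsto_natSqrt.comp tendsto_natSqrt)

theorem radius_pow_le (N : ℕ) : radius N ^ 8 ≤ N := by
  have h1 := Nat.sqrt_le' N
  have h2 := Nat.sqrt_le' (Nat.sqrt N)
  have h3 := Nat.sqrt_le' (Nat.sqrt (Nat.sqrt N))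
  calc radius N ^ 8 = ((radius N ^ 2) ^ 2) ^ 2 := by ring
    _ ≤ (Nat.sqrt (Nat.sqrt N) ^ 2) ^ 2 := by gcongr; exact h3
    _ ≤ (Nat.sqrt N) ^ 2 := by gcongr
    _ ≤ N := h1

theorem lt_radius_pow (N : ℕ) : N < (radius N + 1) ^ 8 := by
  have h1 := Nat.lt_succ_sqrt' N
  have h2 := Nat.lt_succ_sqrt' (Nat.sqrt N)
  have h3 := Nat.lt_succ_sqrt' (Nat.sqrt (Nat.sqrt N))
  simp only [Nat.succ_eq_add_one] at h1 h2 h3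
  calc N < (Nat.sqrt N + 1) ^ 2 := h1
    _ ≤ ((Nat.sqrt (Nat.sqrt N) + 1) ^ 2) ^ 2 := by gcongr; omega
    _ ≤ (((radius N + 1) ^ 2) ^ 2) ^ 2 := by gcongr; exact h3
    _ = (radius N + 1) ^ 8 := by ring

/-- The volume is at most of order (radius N + 1)^8, a polynomial in the radius, which loses against
ρ^radius. -/
theorem tendsto_mul_pow_radius {ρ : ℝ} (h0 : 0 < ρ) (h1 : ρ < 1) :
    Tendsto (fun N : ℕ => (2 * N + 1 : ℝ) * ρ ^ radius N) atTop (𝓝 0) := by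
  have h : Tendsto (fun N : ℕ => 2 * ρ⁻¹ * (((radius N + 1 : ℕ) : ℝ) ^ 8 * ρ ^ (radius N + 1)))
      atTop (𝓝 (2 * ρ⁻¹ * 0)) := by
    refine ((tendsto_pow_const_mul_const_pow_of_abs_lt_one 8 (abs_lt.2 ⟨by linarith, h1⟩)).comp
      ((tendsto_add_atTop_nat 1).comp tendsto_radius)).const_mul _
  rw [mul_zero] at h
  refine squeeze_zero (fun N => by positivity) (fun N => ?_) h
  have hN : (2 * N + 1 : ℝ) ≤ 2 * ((radius N + 1 : ℕ) : ℝ) ^ 8 := by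
    have := lt_radius_pow N
    exact_mod_cast (show 2 * N + 1 ≤ 2 * (radius N + 1) ^ 8 by omega)
  calc (2 * N + 1 : ℝ) * ρ ^ radius N ≤ 2 * ((radius N + 1 : ℕ) : ℝ) ^ 8 * ρ ^ radius N := by
        gcongr
    _ = _ := by rw [pow_succ ρ]; field_simp

theorem scale_le_one (N : ℕ) : scale N ≤ 1 := by
  have h := scale_sq_mul N
  have h0 := scale_pos N
  by_contra! hc
  have : (0 : ℝ) ≤ N := N.cast_nonneg
  nlinarith [mul_pos h0 h0]

/-- The scale is at most N^(-1/2) ≤ radius^(-4), so the product is at most radius^(-2). -/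
theorem tendsto_scale_mul_radius_sq :
    Tendsto (fun N : ℕ => scale N * (radius N : ℝ) ^ 2) atTop (𝓝 0) := by
  have h : Tendsto (fun N : ℕ => (((radius N : ℝ)) ^ 2)⁻¹) atTop (𝓝 0) :=
    tendsto_inv_atTop_zero.comp ((tendsto_pow_atTop two_ne_zero).comp
      (tendsto_natCast_atTop_atTop.comp tendsto_radius))
  refine squeeze_zero' (Eventually.of_forall fun N => ?_) ?_ h
  · have := (scale_pos N).le
    positivity
  · filter_upwards [tendsto_radius.eventually_ge_atTop 1] with N hN
    have hm : (0 : ℝ) < (radius N : ℝ) ^ 2 := by positivity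
    rw [le_inv_comm₀ (mul_pos (scale_pos N) hm) hm, ← one_div, le_div_iff₀ (mul_pos (scale_pos N) hm)]
    have h8 : (radius N : ℝ) ^ 8 ≤ N := by exact_mod_cast radius_pow_le N
    have hs := scale_sq_mul N
    have hsq : (scale N * (radius N : ℝ) ^ 4) ^ 2 ≤ 1 := by
      have := mul_le_mul_of_nonneg_left h8 (mul_pos (scale_pos N) (scale_pos N)).le
      nlinarith [mul_pos (scale_pos N) (scale_pos N), (Nat.cast_nonneg N : (0 : ℝ) ≤ N)]
    have := (sq_le_one_iff₀ (by have := (scale_pos N).le; positivity)).1 hsq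
    linarith

variable {A : Type*} [CStarAlgebra A] (S : MixingChain A)

/-- Since scale²·(2N+1) = 1, the three contributions are of order scale·m², scale·(2N+1)·e^(-Mm) and
(2N+1)·e^(-Mm), with m the radius. -/
theorem tendsto_steinError (k : ℕ) (B : ℝ) :
    Tendsto (fun N => S.steinError N (radius N) k B) atTop (𝓝 0) := by
  have hρ : Real.exp (-S.M) < 1 := Real.exp_zero ▸ Real.exp_lt_exp.2 (neg_neg_of_pos S.M_pos)
  have h1 := tendsto_mul_pow_radius (Real.exp_pos _) hρ
  have h2 : Tendsto (fun N : ℕ => scale N * ((2 * N + 1 : ℝ) * Real.exp (-S.M) ^ radius N)) atTop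
      (𝓝 0) := by
    refine squeeze_zero (fun N => ?_) (fun N => ?_) h1
    · have := (scale_pos N).le
      positivity
    · exact mul_le_of_le_one_left (by positivity) (scale_le_one N)
  have h3 := tendsto_scale_mul_radius_sq
  have h := ((h3.const_mul (299 * 4 ^ k * B ^ 3 + 507 * k ^ 2 * B ^ 3)).add
    (h2.const_mul (3 * S.C * B + 3 * S.C * k * B))).add (h1.const_mul (k * S.C * B ^ 2))
  simp only [mul_zero, add_zero] at h
  refine h.congr fun N => ?_
  have hs := scale_sq_mul N
  have he : Real.exp (-S.M * radius N) = Real.exp (-S.M) ^ radius N := by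
    rw [← Real.exp_nat_mul, mul_comm]
  rw [steinError, he]
  linear_combination (-((299 * 4 ^ k * B ^ 3 + 507 * k ^ 2 * B ^ 3) * (scale N * (radius N) ^ 2))
    - k * S.C * B ^ 2 * ((2 * N + 1) * Real.exp (-S.M) ^ radius N)) * hs

/-- The central limit theorem for products of exponentials of sums of local observables whose
support grows slowly. -/
theorem tendsto_state_prod_expI_array (r : ℕ) (D : Fin r → ℕ → A) (B : ℝ)
    (hD : ∀ k N, D k N ∈ S.region (Icc (-(radius N : ℤ)) (radius N)))
    (hsa : ∀ k N, IsSelfAdjoint (D k N)) (hB : ∀ k N, ‖D k N‖ ≤ B)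
    (h0 : ∀ k N, S.state (D k N) = 0) (c : Fin r → Fin r → ℂ)
    (hc : ∀ k l, Tendsto (fun N => S.state (S.sumOn N (window N) (D k N) *
      S.sumOn N (window N) (D l N))) atTop (𝓝 (c k l))) :
    Tendsto (fun N => S.state (List.ofFn fun k => expI (S.sumOn N (window N) (D k N))).prod) atTop
      (𝓝 (Complex.exp (-∑ k, (c k k / 2 + ∑ l, if l < k then c l k else 0)))) := by
  induction r with
  | zero => simp [S.state_one]
  | succ r ih =>
    have ih := ih (fun k => D k.castSucc) (fun k => hD _) (fun k => hsa _) (fun k => hB _)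
      (fun k => h0 _) (fun k l => c k.castSucc l.castSucc) (fun k l => hc _ _)
    -- The last factor is split off: a is its covariance with the sum of the earlier observables,
    -- which stand to its left, and b is its variance.
    set a : ℕ → ℂ := fun N => S.state (((List.ofFn fun k : Fin r => D k.castSucc N).map
      fun Q => S.sumOn N (window N) Q).sum * S.sumOn N (window N) (D (Fin.last r) N)) with ha
    set b : ℕ → ℂ := fun N => S.state (S.sumOn N (window N) (D (Fin.last r) N) *
      S.sumOn N (window N) (D (Fin.last r) N)) with hb
    have hbl : Tendsto b atTop (𝓝 (c (Fin.last r) (Fin.last r))) := hc _ _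
    have hal : Tendsto a atTop (𝓝 (∑ l : Fin r, c l.castSucc (Fin.last r))) := by
      have := tendsto_finsetSum (Finset.univ : Finset (Fin r)) fun l _ =>
        hc l.castSucc (Fin.last r)
      refine this.congr fun N => ?_
      simp only [ha, List.map_ofFn, List.sum_ofFn, Function.comp_def, Finset.sum_mul, map_sum]
    have hlim : Tendsto (fun N => S.state ((List.ofFn fun k : Fin r =>
        expI (S.sumOn N (window N) (D k.castSucc N))).prod) * Complex.exp (-(a N + b N / 2))) atTop
        (𝓝 (Complex.exp (-∑ k : Fin r, (c k.castSucc k.castSucc / 2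
          + ∑ l : Fin r, if l < k then c l.castSucc k.castSucc else 0))
          * Complex.exp (-(∑ l : Fin r, c l.castSucc (Fin.last r)
            + c (Fin.last r) (Fin.last r) / 2)))) :=
      ih.mul ((Complex.continuous_exp.tendsto _).comp (hal.add (hbl.div_const 2)).neg)
    have herr : Tendsto (fun N => S.steinError N (radius N) (r + 1) B *
        Real.exp (2 * (‖a N‖ + ‖b N‖))) atTop (𝓝 0) := by
      have := (S.tendsto_steinError (r + 1) B).mul ((Real.continuous_exp.tendsto _).comp
        ((hal.norm.add hbl.norm).const_mul 2))
      rwa [zero_mul] at this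
    -- The near parts must have norm at most 1 for the first-order expansion.
    have hsmall : ∀ᶠ N in atTop, scale N * (13 * radius N * B) ≤ 1 := by
      have h1 : Tendsto (fun N : ℕ => 13 * |B| * (scale N * (radius N : ℝ) ^ 2)) atTop (𝓝 0) := by
        simpa using tendsto_scale_mul_radius_sq.const_mul (13 * |B|)
      filter_upwards [h1.eventually_le_const one_pos, tendsto_radius.eventually_ge_atTop 1]
        with N hN hm
      refine le_trans ?_ hN
      have hm1 : (1 : ℝ) ≤ radius N := by exact_mod_cast hm
      have hs := scale_pos N
      calc scale N * (13 * radius N * B) ≤ scale N * (13 * radius N ^ 2 * |B|) := by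
            have h2 : (radius N : ℝ) ≤ radius N ^ 2 := by nlinarith
            refine mul_le_mul_of_nonneg_left ?_ hs.le
            calc 13 * (radius N : ℝ) * B ≤ 13 * radius N * |B| := by
                  gcongr
                  exact le_abs_self B
              _ ≤ 13 * radius N ^ 2 * |B| := by gcongr
        _ = _ := by ring
    have hdiff : Tendsto (fun N => S.state (List.ofFn fun k : Fin (r + 1) =>
        expI (S.sumOn N (window N) (D k N))).prod - S.state ((List.ofFn fun k : Fin r =>
        expI (S.sumOn N (window N) (D k.castSucc N))).prod) * Complex.exp (-(a N + b N / 2))) atTop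
        (𝓝 0) := by
      refine squeeze_zero_norm' ?_ herr
      filter_upwards [hsmall, tendsto_radius.eventually_ge_atTop 1] with N hN hm
      have := S.norm_state_mul_expI_sub_le hm hN (List.ofFn fun k : Fin r => D k.castSucc N)
        (by simp only [List.forall_mem_ofFn_iff]; exact fun k => hD _ _)
        (by simp only [List.forall_mem_ofFn_iff]; exact fun k => hsa _ _)
        (by simp only [List.forall_mem_ofFn_iff]; exact fun k => hB _ _)
        (hD (Fin.last r) N) (hsa _ _) (hB _ _) (h0 _ _) (a := a N) (b := b N) rfl rfl
      rw [List.length_ofFn] at this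
      rw [List.ofFn_succ', List.concat_eq_append, List.prod_append, List.prod_singleton]
      simpa only [List.map_ofFn, Function.comp_def] using this
    have := hdiff.add hlim
    simp only [sub_add_cancel, zero_add] at this
    convert this using 2
    rw [← Complex.exp_add, ← neg_add]
    simp only [Fin.sum_univ_castSucc, Fin.castSucc_lt_castSucc_iff, Fin.castSucc_lt_last, if_true,
      lt_irrefl, if_false, (Fin.castSucc_lt_last _).not_gt, add_zero]
    ring_nf

end MixingChain


namespace MixingChain

/-! ### Convergence of covariances -/

/-- The window and its translate by k differ in at most |k| sites, so the normalized number of pairs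
with difference k tends to 1. -/
theorem le_card_filter_window (N : ℕ) (k : ℤ) :
    2 * N + 1 ≤ ((window N).filter fun j => k + j ∈ window N).card + k.natAbs := by
  have h : Finset.Icc (max (-(N : ℤ)) (-N - k)) (min (N : ℤ) (N - k)) ⊆
      (window N).filter fun j => k + j ∈ window N := fun j hj => by
    simp only [Finset.mem_Icc, Finset.mem_filter] at hj ⊢
    omega
  have h2 := Finset.card_le_card h
  rw [Int.card_Icc] at h2
  omega

theorem tendsto_scale_sq : Tendsto (fun N : ℕ => scale N * scale N) atTop (𝓝 0) := by
  have h : Tendsto (fun N : ℕ => ((N : ℝ))⁻¹) atTop (𝓝 0) :=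
    tendsto_inv_atTop_zero.comp tendsto_natCast_atTop_atTop
  refine squeeze_zero' (Eventually.of_forall fun N => mul_self_nonneg _) ?_ h
  filter_upwards [eventually_gt_atTop 0] with N hN
  have hN' : (0 : ℝ) < N := by exact_mod_cast hN
  rw [← one_div, le_div_iff₀ hN']
  have hs := scale_sq_mul N
  nlinarith [mul_self_nonneg (scale N)]

/-- Cesàro means of a summable function of the difference of two sites. -/
theorem tendsto_sum_sum_sub {a : ℤ → ℂ} (ha : Summable a) :
    Tendsto (fun N : ℕ => ((scale N * scale N : ℝ) : ℂ) *
      ∑ i ∈ window N, ∑ j ∈ window N, a (i - j)) atTop (𝓝 (∑' k, a k)) := by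
  have hrow : ∀ (N : ℕ) (j : ℤ), HasSum (fun k => if k + j ∈ window N then a k else 0)
      (∑ i ∈ window N, a (i - j)) := fun N j => by
    have h : HasSum (fun i => if i ∈ window N then a (i - j) else 0)
        (∑ i ∈ window N, a (i - j)) := by
      have := hasSum_sum_of_ne_finset_zero (L := SummationFilter.unconditional ℤ) (s := window N)
        (f := fun i => if i ∈ window N then a (i - j) else 0) fun i hi => if_neg hi
      rwa [Finset.sum_congr rfl fun i hi => if_pos hi] at this
    have h2 := (Equiv.addRight j).hasSum_iff.2 h
    simpa [Function.comp_def] using h2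
  -- Group the pairs by their difference k. The resulting weights are at most 1 and tend to 1, so
  -- dominated convergence applies with the bound ‖a k‖.
  have hsum : ∀ N : ℕ, ((scale N * scale N : ℝ) : ℂ) *
      ∑ i ∈ window N, ∑ j ∈ window N, a (i - j) = ∑' k : ℤ, ((scale N * scale N *
        ((window N).filter fun j => k + j ∈ window N).card : ℝ) : ℂ) * a k := fun N => by
    rw [Finset.sum_comm]
    have h := (hasSum_sum fun j (_ : j ∈ window N) => hrow N j).mul_left
      ((scale N * scale N : ℝ) : ℂ)
    rw [← h.tsum_eq]
    refine tsum_congr fun k => ?_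
    rw [← Finset.sum_filter, Finset.sum_const, nsmul_eq_mul]
    push_cast
    ring
  simp only [hsum]
  have hbd : ∀ (N : ℕ) (k : ℤ), scale N * scale N *
      ((window N).filter fun j => k + j ∈ window N).card ≤ 1 := fun N k => by
    rw [← scale_sq_mul N, ← card_window]
    refine mul_le_mul_of_nonneg_left ?_ (mul_self_nonneg _)
    exact_mod_cast Finset.card_le_card (Finset.filter_subset _ _)
  refine tendsto_tsum_of_dominated_convergence (bound := fun k => ‖a k‖) ha.norm (fun k => ?_)
    (Eventually.of_forall fun N k => ?_)
  · have h1 : Tendsto (fun N : ℕ => scale N * scale N *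
        ((window N).filter fun j => k + j ∈ window N).card) atTop (𝓝 1) := by
      have hlow : Tendsto (fun N : ℕ => 1 - scale N * scale N * k.natAbs) atTop (𝓝 1) := by
        simpa using (tendsto_scale_sq.mul_const (k.natAbs : ℝ)).const_sub 1
      refine tendsto_of_tendsto_of_tendsto_of_le_of_le hlow tendsto_const_nhds (fun N => ?_)
        (fun N => hbd N k)
      have h2 : (2 * N + 1 : ℝ) ≤ ((window N).filter fun j => k + j ∈ window N).card + k.natAbs := by
        exact_mod_cast le_card_filter_window N k
      have := mul_le_mul_of_nonneg_left h2 (mul_self_nonneg (scale N))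
      rw [scale_sq_mul, mul_add] at this
      simp only
      linarith
    have h2 := ((Complex.continuous_ofReal.tendsto _).comp h1).mul_const (a k)
    simpa [Function.comp_def] using h2
  · rw [norm_mul, Complex.norm_real, Real.norm_of_nonneg (mul_nonneg (mul_self_nonneg _) (Nat.cast_nonneg _))]
    exact mul_le_of_le_one_left (norm_nonneg _) (hbd N k)

variable {A : Type*} [CStarAlgebra A] (S : MixingChain A)

/-- The covariance of `τ_k(Q)` and `R`. -/
def cov (Q R : A) (k : ℤ) : ℂ := S.state (S.shift k Q * R) - S.state Q * S.state R

/-- The observable `Q` shifted to mean zero. -/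
def center (Q : A) : A := Q - S.state Q • (1 : A)

theorem state_center (Q : A) : S.state (S.center Q) = 0 := by
  simp [center, S.state_one]

theorem center_sub (Q R : A) : S.center (Q - R) = S.center Q - S.center R := by
  simp only [center, map_sub, sub_smul]
  abel

theorem norm_center_le (Q : A) : ‖S.center Q‖ ≤ 2 * ‖Q‖ := by
  have h1 := norm_le_one_of_mem_unitary (one_mem (unitary A))
  refine (norm_sub_le _ _).trans ?_
  rw [norm_smul]
  have := mul_le_of_le_one_right (norm_nonneg (S.state Q)) h1
  linarith [S.norm_state_le Q]

/-- Both φ(x²) and φ((x+1)²) = φ(x²) + 2φ(x) + 1 are real. -/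
theorem state_im_of_isSelfAdjoint {x : A} (hx : IsSelfAdjoint x) : (S.state x).im = 0 := by
  have h1 := (Complex.nonneg_iff.1 (S.state_star_mul_self_nonneg x)).2
  have h2 := (Complex.nonneg_iff.1 (S.state_star_mul_self_nonneg (x + 1))).2
  simp only [star_add, hx.star_eq, star_one, add_mul, mul_add, mul_one, one_mul, map_add,
    Complex.add_im, S.state_one, Complex.one_im] at h1 h2
  linarith

theorem isSelfAdjoint_center {x : A} (hx : IsSelfAdjoint x) : IsSelfAdjoint (S.center x) := by
  refine hx.sub (IsSelfAdjoint.smul ?_ (IsSelfAdjoint.one A))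
  exact Complex.conj_eq_iff_im.2 (S.state_im_of_isSelfAdjoint hx)

theorem state_shift_center_mul (i j : ℤ) (Q R : A) :
    S.state (S.shift i (S.center Q) * S.shift j (S.center R)) = S.cov Q R (i - j) := by
  have h : S.state (S.shift i Q * S.shift j R) = S.state (S.shift (i - j) Q * R) := by
    rw [← S.state_shift (-j), map_mul, S.shift_shift, S.shift_shift, neg_add_cancel, S.shift_zero,
      neg_add_eq_sub]
  rw [cov, ← h]
  simp only [center, map_sub, map_smul, map_one, sub_mul, mul_sub, smul_mul_assoc, mul_smul_comm,
    one_mul, mul_one, S.state_shift, smul_eq_mul, S.state_one]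
  ring

/-- The normalized fluctuation of `Q` in `[-N,N]`. -/
def fluctuation (N : ℕ) (Q : A) : A := S.sumOn N (window N) (S.center Q)

theorem tendsto_state_fluctuation_mul {Q R : A} (h : Summable (S.cov Q R)) :
    Tendsto (fun N => S.state (S.fluctuation N Q * S.fluctuation N R)) atTop
      (𝓝 (∑' k, S.cov Q R k)) := by
  refine (tendsto_sum_sum_sub h).congr fun N => ?_
  simp only [fluctuation, sumOn, smul_mul_smul_comm, Finset.sum_mul_sum, map_smul, map_sum,
    S.state_shift_center_mul, smul_eq_mul]
  push_cast
  rfl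

/-- Selfadjoint observables that can be approximated at an exponential rate by selfadjoint
observables in `[-m,m]`. -/
def IsLocalized (θ : ℝ) (Q : A) : Prop :=
  ∃ K : ℝ, ∀ m : ℕ, ∃ D ∈ S.region (Icc (-(m : ℤ)) m), IsSelfAdjoint D ∧ ‖Q - D‖ ≤ K * θ ^ m

theorem norm_cov_le (Q R : A) (k : ℤ) : ‖S.cov Q R k‖ ≤ 2 * (‖Q‖ * ‖R‖) := by
  have h1 : ‖S.state (S.shift k Q * R)‖ ≤ ‖Q‖ * ‖R‖ := (S.norm_state_le _).trans
    ((norm_mul_le _ _).trans (mul_le_mul_of_nonneg_right (S.norm_shift_le _ _) (norm_nonneg _)))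
  have h2 : ‖S.state Q * S.state R‖ ≤ ‖Q‖ * ‖R‖ := by
    rw [norm_mul]
    exact mul_le_mul (S.norm_state_le _) (S.norm_state_le _) (norm_nonneg _) (norm_nonneg _)
  exact (norm_sub_le _ _).trans (by linarith)

theorem summable_pow_natAbs {σ : ℝ} (h0 : 0 ≤ σ) (h1 : σ < 1) :
    Summable fun k : ℤ => σ ^ k.natAbs := by
  have h := summable_geometric_of_lt_one h0 h1
  exact Summable.of_nat_of_neg (by simpa using h) (by simpa using h)

/-- At distance |k| approximate both observables in [-m, m] with m = ⌊|k|/4⌋. The approximation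
errors decay like θ^m; for m > 0 the local parts are more than 3m apart, so their covariance decays
like e^(-Mm). -/
theorem summable_cov {θ : ℝ} (h0 : 0 < θ) (h1 : θ < 1) {Q R : A} (hQ : S.IsLocalized θ Q)
    (hR : S.IsLocalized θ R) : Summable (S.cov Q R) := by
  obtain ⟨K, hK⟩ := hQ
  obtain ⟨L, hL⟩ := hR
  have hK0 : 0 ≤ K := by
    obtain ⟨D, -, -, hD⟩ := hK 0
    simpa using (norm_nonneg _).trans hD
  have hL0 : 0 ≤ L := by
    obtain ⟨D, -, -, hD⟩ := hL 0
    simpa using (norm_nonneg _).trans hD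
  have hM1 : Real.exp (-S.M) < 1 := Real.exp_zero ▸ Real.exp_lt_exp.2 (neg_neg_of_pos S.M_pos)
  obtain ⟨ρ, hρ⟩ : ∃ ρ, ρ = max θ (Real.exp (-S.M)) := ⟨_, rfl⟩
  have hρ0 : 0 < ρ := hρ ▸ lt_max_of_lt_left h0
  have hρ1 : ρ < 1 := hρ ▸ max_lt h1 hM1
  -- The fourth root turns decay in ⌊|k|/4⌋ into geometric decay in |k|.
  obtain ⟨σ, hσ0, hσ⟩ : ∃ σ : ℝ, 0 < σ ∧ σ ^ 4 = ρ :=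
    ⟨Real.sqrt (Real.sqrt ρ), by positivity, by
      rw [show (4 : ℕ) = 2 * 2 from rfl, pow_mul, Real.sq_sqrt (Real.sqrt_nonneg _),
        Real.sq_sqrt hρ0.le]⟩
  have hσ1 : σ < 1 := by
    by_contra! hc
    exact absurd (one_le_pow₀ hc (n := 4)) (by rw [hσ]; exact not_le.2 hρ1)
  set B := ‖Q‖ + K + (‖R‖ + L) with hB
  set C1 : ℝ := 2 * (‖Q‖ * ‖R‖) + (2 * (K * ‖R‖) + 2 * (B * L) + S.C * B ^ 2) with hC1
  have hC := S.C_pos.le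
  have hB0 : 0 ≤ B := by positivity
  have key : ∀ k : ℤ, ‖S.cov Q R k‖ ≤ C1 * ρ ^ (k.natAbs / 4) := by
    intro k
    set m := k.natAbs / 4 with hm
    rcases Nat.eq_zero_or_pos m with h | h
    · rw [h, pow_zero, mul_one]
      refine (S.norm_cov_le Q R k).trans (le_add_of_nonneg_right ?_)
      positivity
    · obtain ⟨D, hD, -, hQD⟩ := hK m
      obtain ⟨E, hE, -, hRE⟩ := hL m
      have hθρ : θ ^ m ≤ ρ ^ m := pow_le_pow_left₀ h0.le (hρ ▸ le_max_left _ _) m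
      have heρ : Real.exp (-S.M * m) ≤ ρ ^ m := by
        rw [mul_comm, Real.exp_nat_mul]
        exact pow_le_pow_left₀ (Real.exp_nonneg _) (hρ ▸ le_max_right _ _) m
      have hθ1 : θ ^ m ≤ 1 := pow_le_one₀ h0.le h1.le
      have hDB : ‖D‖ ≤ B := by
        have h2 : ‖D‖ ≤ ‖Q‖ + ‖Q - D‖ := by
          simpa using norm_sub_le Q (Q - D)
        have := mul_le_of_le_one_right hK0 hθ1
        linarith [norm_nonneg R]
      have hEB : ‖E‖ ≤ B := by
        have h2 : ‖E‖ ≤ ‖R‖ + ‖R - E‖ := by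
          simpa using norm_sub_le R (R - E)
        have := mul_le_of_le_one_right hL0 hθ1
        linarith [norm_nonneg Q]
      have e : S.cov Q R k = S.cov (Q - D) R k + S.cov D (R - E) k + S.cov D E k := by
        simp only [cov, map_sub, sub_mul, mul_sub]
        ring
      have b1 : ‖S.cov (Q - D) R k‖ ≤ 2 * (K * ρ ^ m * ‖R‖) := by
        refine (S.norm_cov_le _ _ k).trans ?_
        gcongr
        exact hQD.trans (by gcongr)
      have b2 : ‖S.cov D (R - E) k‖ ≤ 2 * (B * (L * ρ ^ m)) := by
        refine (S.norm_cov_le _ _ k).trans ?_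
        gcongr
        exact hRE.trans (by gcongr)
      have b3 : ‖S.cov D E k‖ ≤ S.C * ρ ^ m * B ^ 2 := by
        have := S.norm_state_mul_le_of_far h (i := k) (j := 0) (by
          rw [sub_zero, Int.abs_eq_natAbs]; omega) hD hE hDB hEB
        rw [S.shift_zero] at this
        exact this.trans (by gcongr)
      rw [e]
      refine ((norm_add_le _ _).trans (add_le_add ((norm_add_le _ _).trans
        (add_le_add b1 b2)) b3)).trans ?_
      have : 0 ≤ 2 * (‖Q‖ * ‖R‖) * ρ ^ m := by positivity
      rw [hC1]
      linarith
  -- The factor σ^(-3) pays for rounding: |k| ≤ 4⌊|k|/4⌋ + 3.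
  refine Summable.of_norm_bounded ((summable_pow_natAbs hσ0.le hσ1).mul_left (C1 * (σ ^ 3)⁻¹))
    fun k => (key k).trans ?_
  rw [mul_assoc]
  refine mul_le_mul_of_nonneg_left ?_ (by positivity)
  rw [← hσ, ← pow_mul, ← div_eq_inv_mul, le_div_iff₀ (by positivity), ← pow_add]
  exact pow_le_pow_of_le_one hσ0.le hσ1.le (by omega)

end MixingChain


namespace MixingChain

variable {A : Type*} [CStarAlgebra A] (S : MixingChain A)

/-! ### The joint central limit theorem for exponentially localized observables -/

theorem norm_fluctuation_le (N : ℕ) (Q : A) :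
    ‖S.fluctuation N Q‖ ≤ scale N * ((2 * N + 1) * (2 * ‖Q‖)) := by
  refine (S.norm_sumOn_le N _ _).trans ?_
  rw [card_window]
  have := S.norm_center_le Q
  have := (scale_pos N).le
  gcongr

theorem fluctuation_sub (N : ℕ) (Q R : A) :
    S.fluctuation N (Q - R) = S.fluctuation N Q - S.fluctuation N R := by
  simp only [fluctuation, center_sub, sumOn, map_sub, Finset.sum_sub_distrib, smul_sub]

theorem fluctuation_sum {r : ℕ} (N : ℕ) (Q : Fin r → A) :
    S.fluctuation N (∑ k, Q k) = ∑ k, S.fluctuation N (Q k) := by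
  have hc : S.center (∑ k, Q k) = ∑ k, S.center (Q k) := by
    simp only [center, map_sum, Finset.sum_smul, Finset.sum_sub_distrib]
  simp only [fluctuation, hc, sumOn, map_sum]
  rw [Finset.sum_comm, Finset.smul_sum]

theorem isSelfAdjoint_fluctuation (N : ℕ) {Q : A} (hQ : IsSelfAdjoint Q) :
    IsSelfAdjoint (S.fluctuation N Q) :=
  S.isSelfAdjoint_sumOn _ _ (S.isSelfAdjoint_center hQ)

theorem norm_mul_sub_mul_le (x y x' y' : A) :
    ‖x * y - x' * y'‖ ≤ ‖x - x'‖ * ‖y‖ + ‖x'‖ * ‖y - y'‖ := by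
  have e : x * y - x' * y' = (x - x') * y + x' * (y - y') := by noncomm_ring
  rw [e]
  exact (norm_add_le _ _).trans (add_le_add (norm_mul_le _ _) (norm_mul_le _ _))

/-- At volume N each observable is replaced by its approximation in the interval of radius `radius
N`, to which the array theorem applies. The replacement changes exponentials and covariances by at
most a constant times (2N+1)·θ^radius. -/
theorem tendsto_state_prod_expI {θ : ℝ} (h0 : 0 < θ) (h1 : θ < 1) {r : ℕ} (Q : Fin r → A)
    (hsa : ∀ k, IsSelfAdjoint (Q k)) (hQ : ∀ k, S.IsLocalized θ (Q k)) :
    Tendsto (fun N => S.state (List.ofFn fun k => expI (S.fluctuation N (Q k))).prod) atTop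
      (𝓝 (Complex.exp (-∑ k, ((∑' i, S.cov (Q k) (Q k) i) / 2
        + ∑ l, if l < k then ∑' i, S.cov (Q l) (Q k) i else 0)))) := by
  choose K D hD hDsa hQD using hQ
  have hK0 : ∀ k, 0 ≤ K k := fun k => by simpa using (norm_nonneg _).trans (hQD k 0)
  obtain ⟨L, hL0, hL⟩ : ∃ L : ℝ, 0 ≤ L ∧ ∀ k, K k ≤ L :=
    ⟨∑ k, K k, Finset.sum_nonneg fun k _ => hK0 k,
      fun k => Finset.single_le_sum (fun k _ => hK0 k) (Finset.mem_univ k)⟩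
  obtain ⟨G, hG0, hG⟩ : ∃ G : ℝ, 0 ≤ G ∧ ∀ k, ‖Q k‖ ≤ G :=
    ⟨∑ k, ‖Q k‖, Finset.sum_nonneg fun k _ => norm_nonneg _,
      fun k => Finset.single_le_sum (fun k _ => norm_nonneg (Q k)) (Finset.mem_univ k)⟩
  have hQDL : ∀ k m, ‖Q k - D k m‖ ≤ L * θ ^ m := fun k m =>
    (hQD k m).trans (mul_le_mul_of_nonneg_right (hL k) (by positivity))
  have hDB : ∀ k m, ‖D k m‖ ≤ G + L := fun k m => by
    have h2 : ‖D k m‖ ≤ ‖Q k‖ + ‖Q k - D k m‖ := by simpa using norm_sub_le (Q k) (Q k - D k m)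
    have h3 := mul_le_of_le_one_right hL0 (pow_le_one₀ h0.le h1.le (n := m))
    linarith [hG k, hQDL k m]
  have hdiff : ∀ k N, ‖S.fluctuation N (Q k) - S.fluctuation N (D k (radius N))‖
      ≤ scale N * (2 * L * ((2 * N + 1) * θ ^ radius N)) := fun k N => by
    rw [← S.fluctuation_sub]
    refine (S.norm_fluctuation_le N _).trans (mul_le_mul_of_nonneg_left ?_ (scale_pos N).le)
    calc (2 * N + 1 : ℝ) * (2 * ‖Q k - D k (radius N)‖)
        ≤ (2 * N + 1) * (2 * (L * θ ^ radius N)) := by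
          gcongr
          exact hQDL _ _
      _ = _ := by ring
  have hlim := tendsto_mul_pow_radius h0 h1
  have hcov : ∀ k l, Tendsto (fun N => S.state (S.fluctuation N (D k (radius N)) *
      S.fluctuation N (D l (radius N)))) atTop (𝓝 (∑' i, S.cov (Q k) (Q l) i)) := by
    intro k l
    have h := S.tendsto_state_fluctuation_mul
      (S.summable_cov h0 h1 ⟨K k, fun m => ⟨D k m, hD k m, hDsa k m, hQD k m⟩⟩
        ⟨K l, fun m => ⟨D l m, hD l m, hDsa l m, hQD l m⟩⟩)
    have herr : Tendsto (fun N => S.state (S.fluctuation N (D k (radius N)) *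
        S.fluctuation N (D l (radius N)) - S.fluctuation N (Q k) * S.fluctuation N (Q l))) atTop
        (𝓝 0) := by
      -- Each fluctuation brings a factor scale·(2N+1); the two together give 2N+1.
      have h8 := hlim.const_mul (4 * L * (G + L) + 4 * L * G)
      rw [mul_zero] at h8
      refine squeeze_zero_norm (fun N => ?_) h8
      refine (S.norm_state_le _).trans ((norm_mul_sub_mul_le _ _ _ _).trans ?_)
      rw [norm_sub_rev, norm_sub_rev (S.fluctuation N (D l (radius N)))]
      have hs := (scale_pos N).le
      have b1 : ‖S.fluctuation N (D l (radius N))‖ ≤ scale N * ((2 * N + 1) * (2 * (G + L))) :=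
        (S.norm_fluctuation_le N _).trans (by gcongr; exact hDB _ _)
      have b2 : ‖S.fluctuation N (Q k)‖ ≤ scale N * ((2 * N + 1) * (2 * G)) :=
        (S.norm_fluctuation_le N _).trans (by gcongr; exact hG _)
      refine (add_le_add (mul_le_mul (hdiff k N) b1 (norm_nonneg _) (by positivity))
        (mul_le_mul b2 (hdiff l N) (norm_nonneg _) (by positivity))).trans_eq ?_
      linear_combination ((4 * L * (G + L) + 4 * L * G) * ((2 * N + 1) * θ ^ radius N))
        * scale_sq_mul N
    have := herr.add h
    simpa only [map_sub, sub_add_cancel, zero_add] using this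
  have harr := S.tendsto_state_prod_expI_array r (fun k N => S.center (D k (radius N)))
    (2 * (G + L)) (fun k N => sub_mem (hD k _) ((S.region _).smul_mem (one_mem _) _))
    (fun k N => S.isSelfAdjoint_center (hDsa k _))
    (fun k N => (S.norm_center_le _).trans (by linarith [hDB k (radius N)]))
    (fun k N => S.state_center _) (fun k l => ∑' i, S.cov (Q k) (Q l) i) hcov
  have herr : Tendsto (fun N => S.state ((List.ofFn fun k => expI (S.fluctuation N (Q k))).prod
      - (List.ofFn fun k => expI (S.fluctuation N (D k (radius N)))).prod)) atTop (𝓝 0) := by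
    have h8 := hlim.const_mul (r * (2 * L))
    rw [mul_zero] at h8
    refine squeeze_zero_norm (fun N => (S.norm_state_le _).trans ?_) h8
    rw [List.ofFn_eq_map, List.ofFn_eq_map]
    refine (norm_list_prod_expI_sub_le (List.finRange r)
      (fun k _ => S.isSelfAdjoint_fluctuation N (hsa k))
      (fun k _ => S.isSelfAdjoint_fluctuation N (hDsa k _)) (fun k _ => hdiff k N)).trans ?_
    rw [List.length_finRange, mul_assoc (r : ℝ)]
    exact mul_le_mul_of_nonneg_left (mul_le_of_le_one_left (by positivity) (scale_le_one N))
      (Nat.cast_nonneg r)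
  have := herr.add harr
  simp only [map_sub] at this
  refine (this.congr fun N => ?_).trans_eq ?_
  · exact sub_add_cancel _ _
  · rw [zero_add]

/-- The terms of the commutator form. -/
theorem state_commutator_eq (Q R : A) (k : ℤ) :
    S.state (S.shift k Q * R - R * S.shift k Q) = S.cov Q R k - S.cov R Q (-k) := by
  have h : S.state (R * S.shift k Q) = S.state (S.shift (-k) R * Q) := by
    rw [← S.state_shift (-k), map_mul, S.shift_shift, neg_add_cancel, S.shift_zero]
  rw [cov, cov, map_sub, h]
  ring

theorem hasSum_state_commutator {Q R : A} (h : Summable (S.cov Q R)) (h' : Summable (S.cov R Q)) :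
    HasSum (fun k => S.state (S.shift k Q * R - R * S.shift k Q))
      (∑' k, S.cov Q R k - ∑' k, S.cov R Q k) := by
  simp only [S.state_commutator_eq]
  exact h.hasSum.sub ((Equiv.neg ℤ).hasSum_iff.2 h'.hasSum)

/-- The algebraic identity between the two forms of the limiting covariance. -/
theorem sum_triangle_eq {r : ℕ} (c : Fin r → Fin r → ℂ) :
    -∑ k, (c k k / 2 + ∑ l, if l < k then c l k else 0) =
      -(∑ k, ∑ l, c k l) / 2 + -(1 / 2) * ∑ k, ∑ l ∈ Finset.Ioi k, (c k l - c l k) := by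
  have hI : ∀ k (f : Fin r → ℂ), ∑ l ∈ Finset.Ioi k, f l = ∑ l, if k < l then f l else 0 := by
    intro k f
    rw [← Finset.sum_filter]
    congr 1
    ext l
    simp
  have hsplit : ∀ k l, c k l = (if k < l then c k l else 0) + (if l < k then c k l else 0)
      + if k = l then c k l else 0 := by
    intro k l
    rcases lt_trichotomy k l with h | h | h
    · simp [h, h.not_gt, h.ne]
    · simp [h]
    · simp [h, h.not_gt, h.ne']
  have h1 : ∑ k, ∑ l, c k l = ∑ k, ∑ l, (if k < l then c k l else 0)
      + ∑ k, ∑ l, (if l < k then c k l else 0) + ∑ k, c k k := by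
    simp only [← Finset.sum_add_distrib]
    refine Finset.sum_congr rfl fun k _ => ?_
    rw [Finset.sum_congr rfl fun l _ => hsplit k l]
    simp [Finset.sum_add_distrib]
  have h2 : ∑ k, ∑ l, (if k < l then c k l else 0) = ∑ k, ∑ l, (if l < k then c l k else 0) :=
    Finset.sum_comm
  have h3 : ∑ k, ∑ l, (if k < l then c l k else 0) = ∑ k, ∑ l, (if l < k then c k l else 0) :=
    Finset.sum_comm
  simp only [hI, Finset.sum_add_distrib, ← Finset.sum_div]
  have h4 : ∀ k l : Fin r, (if k < l then c k l - c l k else 0) =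
      (if k < l then c k l else 0) - (if k < l then c l k else 0) := by
    intros
    split_ifs <;> simp
  simp only [h4, Finset.sum_sub_distrib]
  rw [h1, h2, h3]
  ring

/-- The joint central limit theorem. -/
theorem joint_central_limit {θ : ℝ} (h0 : 0 < θ) (h1 : θ < 1) {r : ℕ} (Q : Fin r → A)
    (hsa : ∀ k, IsSelfAdjoint (Q k)) (hQ : ∀ k, S.IsLocalized θ (Q k)) :
    ∃ t : ℝ, 0 ≤ t ∧
      Tendsto (fun N => S.state (S.fluctuation N (∑ k, Q k) * S.fluctuation N (∑ k, Q k))) atTop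
        (𝓝 (t : ℂ)) ∧
      (∀ k l, Summable fun i => S.state (S.shift i (Q k) * Q l - Q l * S.shift i (Q k))) ∧
      Tendsto (fun N => S.state (List.ofFn fun k => expI (S.fluctuation N (Q k))).prod) atTop
        (𝓝 (Complex.exp (-(t : ℂ) / 2) * Complex.exp (-(1 / 2) * ∑ k, ∑ l ∈ Finset.Ioi k,
          ∑' i, S.state (S.shift i (Q k) * Q l - Q l * S.shift i (Q k))))) := by
  have hs : ∀ k l, Summable (S.cov (Q k) (Q l)) := fun k l => S.summable_cov h0 h1 (hQ k) (hQ l)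
  set c : Fin r → Fin r → ℂ := fun k l => ∑' i, S.cov (Q k) (Q l) i with hc
  have hvar : Tendsto (fun N => S.state (S.fluctuation N (∑ k, Q k) * S.fluctuation N (∑ k, Q k)))
      atTop (𝓝 (∑ k, ∑ l, c k l)) := by
    simp only [S.fluctuation_sum, Finset.sum_mul_sum, map_sum]
    exact tendsto_finsetSum _ fun k _ => tendsto_finsetSum _ fun l _ =>
      S.tendsto_state_fluctuation_mul (hs k l)
  have hnn : 0 ≤ ∑ k, ∑ l, c k l := by
    refine ge_of_tendsto' hvar fun N => ?_
    have hX : IsSelfAdjoint (S.fluctuation N (∑ k, Q k)) :=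
      S.isSelfAdjoint_fluctuation N (isSelfAdjoint_sum _ fun k _ => hsa k)
    have := S.state_star_mul_self_nonneg (S.fluctuation N (∑ k, Q k))
    rwa [hX.star_eq] at this
  obtain ⟨hre, him⟩ := Complex.nonneg_iff.1 hnn
  have hreal : (((∑ k, ∑ l, c k l).re : ℝ) : ℂ) = ∑ k, ∑ l, c k l :=
    Complex.ext rfl (by simpa using him)
  refine ⟨(∑ k, ∑ l, c k l).re, hre, ?_, fun k l =>
    (S.hasSum_state_commutator (hs k l) (hs l k)).summable, ?_⟩
  · rwa [hreal]
  · rw [hreal, ← Complex.exp_add]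
    simp only [fun k l => (S.hasSum_state_commutator (hs k l) (hs l k)).tsum_eq]
    rw [← sum_triangle_eq]
    exact S.tendsto_state_prod_expI h0 h1 Q hsa hQ

end MixingChain


/-! ### The spin chain: regions and translations -/

variable {d : ℕ}

theorem site_commute {j k : ℤ} (h : j ≠ k) (P Q : Matrix (Fin d) (Fin d) ℂ) :
    Commute (site j P) (site k Q) := by
  refine Subtype.ext ?_
  change siteOp j P * siteOp k Q = siteOp k Q * siteOp j P
  ext f σ
  simp only [_root_.mul_apply_eq_comp, siteOp_apply, Function.update_of_ne h,
    Function.update_of_ne h.symm, Finset.mul_sum]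
  rw [Finset.sum_comm]
  refine Finset.sum_congr rfl fun a _ => Finset.sum_congr rfl fun b _ => ?_
  rw [Function.update_comm h]
  ring

/-- The generators of the local algebras. -/
def sites (Λ : Set ℤ) : Set (SpinChain d) :=
  {x | ∃ j ∈ Λ, ∃ Q : Matrix (Fin d) (Fin d) ℂ, x = site j Q}

theorem region_le {Λ : Set ℤ} {T : StarSubalgebra ℂ (SpinChain d)}
    (hT : IsClosed (T : Set (SpinChain d))) (h : sites Λ ⊆ (T : Set (SpinChain d))) : region Λ ≤ T :=
  StarSubalgebra.topologicalClosure_minimal (StarAlgebra.adjoin_le h) hT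

theorem isClosed_region (Λ : Set ℤ) : IsClosed (region (d := d) Λ : Set (SpinChain d)) :=
  StarSubalgebra.isClosed_topologicalClosure _

theorem sites_subset_region (Λ : Set ℤ) : sites Λ ⊆ (region (d := d) Λ : Set (SpinChain d)) :=
  (StarAlgebra.subset_adjoin ℂ _).trans (StarSubalgebra.le_topologicalClosure _)

theorem region_mono {Λ Λ' : Set ℤ} (h : Λ ⊆ Λ') : region (d := d) Λ ≤ region Λ' :=
  region_le (isClosed_region Λ') fun _ ⟨j, hj, Q, hQ⟩ => sites_subset_region Λ' ⟨j, h hj, Q, hQ⟩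

theorem isClosed_centralizer (s : Set (SpinChain d)) :
    IsClosed (StarSubalgebra.centralizer ℂ s : Set (SpinChain d)) := by
  rw [StarSubalgebra.coe_centralizer]
  exact Set.isClosed_centralizer _

/-- Centralizers are closed star subalgebras, so commutation passes from generators to the generated
algebra, first in one argument and then in the other. -/
theorem region_commute {Λ Λ' : Set ℤ} (h : Disjoint Λ Λ') {x y : SpinChain d}
    (hx : x ∈ region (d := d) Λ) (hy : y ∈ region (d := d) Λ') : Commute x y := by
  have h1 : region (d := d) Λ' ≤ StarSubalgebra.centralizer ℂ (sites (d := d) Λ) := by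
    refine region_le (isClosed_centralizer _) ?_
    rintro _ ⟨k, hk, Q, rfl⟩
    rw [SetLike.mem_coe, StarSubalgebra.mem_centralizer_iff]
    rintro _ ⟨j, hj, P, rfl⟩
    have hjk : j ≠ k := fun e => Set.disjoint_left.1 h hj (e ▸ hk)
    rw [← map_star]
    exact ⟨(site_commute hjk P Q).eq, (site_commute hjk (star P) Q).eq⟩
  have h2 : region (d := d) Λ ≤ StarSubalgebra.centralizer ℂ (region (d := d) Λ' : Set (SpinChain d)) := by
    refine region_le (isClosed_centralizer _) ?_
    intro z hz
    rw [SetLike.mem_coe, StarSubalgebra.mem_centralizer_iff]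
    intro g hg
    exact ⟨((StarSubalgebra.mem_centralizer_iff ℂ |>.1 (h1 hg) z hz).1).symm,
      ((StarSubalgebra.mem_centralizer_iff ℂ |>.1 (h1 (star_mem hg)) z hz).1).symm⟩
  exact ((StarSubalgebra.mem_centralizer_iff ℂ |>.1 (h2 hx) y hy).1).symm

theorem norm_translate_le (k : ℤ) (x : SpinChain d) : ‖translate k x‖ ≤ ‖x‖ :=
  NonUnitalStarAlgHom.norm_apply_le (translate k) x

theorem continuous_translate (k : ℤ) : Continuous (translate (d := d) k) :=
  AddMonoidHomClass.continuous_of_bound (translate (d := d) k) 1 fun x => by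
    rw [one_mul]
    exact norm_translate_le k x

theorem translate_mem {Λ : Set ℤ} (k : ℤ) {x : SpinChain d} (hx : x ∈ region (d := d) Λ) :
    translate k x ∈ region (d := d) ((fun i => i + k) '' Λ) := by
  have h : region (d := d) Λ ≤ (region (d := d) ((fun i => i + k) '' Λ)).comap (translate (d := d) k) := by
    refine region_le ((isClosed_region _).preimage (continuous_translate k)) ?_
    rintro _ ⟨j, hj, Q, rfl⟩
    change translate k (site j Q) ∈ region (d := d) _
    rw [translate_site]
    exact sites_subset_region _ ⟨j + k, ⟨j, hj, rfl⟩, Q, rfl⟩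
  exact h hx

theorem translate_zero (x : SpinChain d) : translate 0 x = x := by
  refine Subtype.ext ?_
  change shiftConj 0 (x : ConfSpace d →L[ℂ] ConfSpace d) = x
  have h : (permOp (shiftConf (d := d) 0)).symm = LinearIsometryEquiv.refl ℂ _ := by
    ext f σ
    simp [shiftConf]
  ext f σ
  rw [shiftConj_apply, h]
  simp [shiftConf]

theorem translate_translate (j k : ℤ) (x : SpinChain d) :
    translate j (translate k x) = translate (j + k) x := by
  refine Subtype.ext ?_
  change shiftConj j (shiftConj k (x : ConfSpace d →L[ℂ] ConfSpace d)) = shiftConj (j + k) x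
  have h : ∀ f : ConfSpace d, (permOp (shiftConf k)).symm ((permOp (shiftConf j)).symm f) =
      (permOp (shiftConf (j + k))).symm f := fun f => by
    ext σ
    simp only [permOp_symm_apply]
    refine congrArg f (funext fun i => ?_)
    simp [shiftConf, sub_sub, add_comm j k]
  ext f σ
  simp only [shiftConj_apply, h, permOp_apply]
  refine congrArg _ (funext fun i => ?_)
  simp [shiftConf, add_assoc, add_comm j k]

/-! ### States are contractive -/

section PositiveFunctional

variable {A : Type*} [CStarAlgebra A] {φ : A →ₗ[ℂ] ℂ}

/-- Polarization: positivity at x, x + 1 and x + i makes the imaginary parts of φ(x) and φ(x*)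
opposite and their real parts equal. -/
theorem map_star_of_positive (hpos : ∀ x, 0 ≤ φ (star x * x)) (hone : φ 1 = 1)
    (x : A) : φ (star x) = star (φ x) := by
  have h1 := (Complex.nonneg_iff.1 (hpos x)).2
  have h2 := (Complex.nonneg_iff.1 (hpos (x + 1))).2
  have h3 := (Complex.nonneg_iff.1 (hpos (x + Complex.I • 1))).2
  simp only [star_add, star_one, star_smul, add_mul, mul_add, mul_one, one_mul, map_add,
    Complex.add_im, hone, Complex.one_im, smul_mul_assoc, mul_smul_comm, map_smul,
    smul_eq_mul] at h1 h2 h3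
  simp at h1 h2 h3
  refine Complex.ext ?_ ?_
  · simp; linarith
  · simp; linarith

/-- Nonnegative variance, φ((x - φ(x))*(x - φ(x))) ≥ 0, gives |φ(x)|² ≤ φ(x*x), and x*x ≤ ‖x‖². -/
theorem norm_le_of_positive (hpos : ∀ x, 0 ≤ φ (star x * x)) (hone : φ 1 = 1) (x : A) :
    ‖φ x‖ ≤ ‖x‖ := by
  let _ : PartialOrder A := CStarAlgebra.spectralOrder _
  let _ : StarOrderedRing A := CStarAlgebra.spectralOrderedRing _
  have h1 : φ (star x * x) ≤ ((‖x‖ ^ 2 : ℝ) : ℂ) := by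
    have hle : star x * x ≤ algebraMap ℝ A (‖x‖ ^ 2) :=
      CStarAlgebra.star_mul_le_algebraMap_norm_sq
    obtain ⟨y, hy⟩ := CStarAlgebra.nonneg_iff_eq_star_mul_self.1 (sub_nonneg.2 hle)
    have := hpos y
    rw [← hy, map_sub, sub_nonneg, Algebra.algebraMap_eq_smul_one] at this
    have e : φ ((‖x‖ ^ 2) • (1 : A)) = ((‖x‖ ^ 2 : ℝ) : ℂ) := by
      rw [← Complex.coe_smul, map_smul, hone, smul_eq_mul, mul_one]
    rwa [e] at this
  have h2 := hpos (x - φ x • 1)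
  have e : φ (star (x - φ x • 1) * (x - φ x • 1)) = φ (star x * x) - ((‖φ x‖ ^ 2 : ℝ) : ℂ) := by
    simp only [star_sub, star_smul, star_one, sub_mul, mul_sub, smul_mul_assoc, mul_smul_comm,
      one_mul, mul_one, map_sub, map_smul, hone, smul_eq_mul,
      map_star_of_positive hpos hone, RCLike.star_def, Complex.ofReal_pow, ← Complex.mul_conj']
    ring
  rw [e, sub_nonneg] at h2
  have h3 : ((‖φ x‖ ^ 2 : ℝ) : ℂ) ≤ ((‖x‖ ^ 2 : ℝ) : ℂ) := h2.trans h1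
  rw [Complex.real_le_real] at h3
  exact (sq_le_sq₀ (norm_nonneg _) (norm_nonneg _)).1 h3

end PositiveFunctional

theorem IsState.norm_le {φ : SpinChain d →ₗ[ℂ] ℂ} (h : IsState φ) (x : SpinChain d) :
    ‖φ x‖ ≤ ‖x‖ :=
  norm_le_of_positive h.nonneg h.map_one x

/-! ### Exponential mixing of finitely correlated states -/

/-- Pointwise convergence to zero of the powers of an endomorphism of a finite-dimensional space is
exponentially fast and uniform. -/
theorem exists_norm_pow_le {V : Type*} [NormedAddCommGroup V] [NormedSpace ℂ V]
    [FiniteDimensional ℂ V] (T : V →L[ℂ] V) (hT : ∀ v, Tendsto (fun n => (T ^ n) v) atTop (𝓝 0)) :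
    ∃ C M : ℝ, 0 < C ∧ 0 < M ∧ ∀ n : ℕ, ‖T ^ n‖ ≤ C * Real.exp (-M * n) := by
  obtain ⟨c, hc, hcT⟩ := (Module.finBasis ℂ V).exists_opNorm_le (F := V)
  have hsum : Tendsto (fun n => ∑ i, ‖(T ^ n) (Module.finBasis ℂ V i)‖) atTop (𝓝 0) := by
    have := tendsto_finsetSum Finset.univ fun i (_ : i ∈ Finset.univ) =>
      (hT (Module.finBasis ℂ V i)).norm
    simpa using this
  have hnorm : ∀ n, ‖T ^ n‖ ≤ c * ∑ i, ‖(T ^ n) (Module.finBasis ℂ V i)‖ := fun n =>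
    hcT (Finset.sum_nonneg fun i _ => norm_nonneg _) fun i =>
      Finset.single_le_sum (f := fun i => ‖(T ^ n) (Module.finBasis ℂ V i)‖)
        (fun i _ => norm_nonneg _) (Finset.mem_univ i)
  -- Convergence on a basis is norm convergence, so some power p has norm at most 1/e;
  -- submultiplicativity then gives the rate 1/p.
  have hev : ∀ᶠ n in atTop, ‖T ^ n‖ ≤ Real.exp (-1) := by
    have h := hsum.const_mul c
    rw [mul_zero] at h
    filter_upwards [h.eventually_le_const (Real.exp_pos (-1))] with n hn
    exact (hnorm n).trans hn
  obtain ⟨p, hp, hp0⟩ := (hev.and (eventually_gt_atTop 0)).exists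
  have hp0' : (0 : ℝ) < p := by exact_mod_cast hp0
  set G := ∑ r ∈ Finset.range p, ‖T ^ r‖ with hG
  have hG0 : 0 ≤ G := Finset.sum_nonneg fun _ _ => norm_nonneg _
  -- G + 1 bounds the powers below p and is positive; the factor e absorbs the rounding n/p ≤ ⌊n/p⌋
  -- + 1.
  refine ⟨(G + 1) * Real.exp 1, (p : ℝ)⁻¹, by positivity, by positivity, fun n => ?_⟩
  have hpow : ∀ (k r : ℕ), ‖T ^ (p * k + r)‖ ≤ Real.exp (-1) ^ k * ‖T ^ r‖ := by
    intro k r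
    induction k with
    | zero => simp
    | succ k ih =>
      rw [show p * (k + 1) + r = p + (p * k + r) by ring, pow_add, pow_succ']
      refine (norm_mul_le _ _).trans ?_
      rw [mul_assoc]
      exact mul_le_mul hp ih (norm_nonneg _) (Real.exp_nonneg _)
  have hr : ‖T ^ (n % p)‖ ≤ G + 1 := (Finset.single_le_sum (f := fun r => ‖T ^ r‖)
    (fun _ _ => norm_nonneg _) (Finset.mem_range.2 (Nat.mod_lt n hp0))).trans (by linarith)
  have hn := hpow (n / p) (n % p)
  rw [Nat.div_add_mod] at hn
  refine hn.trans ?_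
  rw [mul_comm, mul_assoc, ← Real.exp_nat_mul, ← Real.exp_add]
  refine mul_le_mul hr (Real.exp_le_exp.2 ?_) (Real.exp_nonneg _) (by positivity)
  have h4 : (n : ℝ) ≤ p * ((n / p : ℕ) : ℝ) + p := by
    have h5 := Nat.div_add_mod n p
    have h6 := Nat.mod_lt n hp0
    exact_mod_cast (show n ≤ p * (n / p) + p by omega)
  have h7 : (p : ℝ)⁻¹ * n ≤ ((n / p : ℕ) : ℝ) + 1 := by
    rw [inv_mul_le_iff₀ hp0']
    linarith
  linarith


/-- An endomorphism whose powers converge weakly to zero on an invariant finite-dimensional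
subspace contracts this subspace exponentially. -/
theorem exists_norm_pow_le_of_weak {D : Type*} [NormedAddCommGroup D] [NormedSpace ℂ D]
    (W : Submodule ℂ D) (hfin : FiniteDimensional ℂ W) (T : D →ₗ[ℂ] D) (hTW : ∀ w ∈ W, T w ∈ W)
    {ι : Type*} (ev : ι → D →ₗ[ℂ] ℂ) (hev : ∀ w ∈ W, (∀ i, ev i w = 0) → w = 0)
    (hlim : ∀ w ∈ W, ∀ i, Tendsto (fun n => ev i ((T ^ n) w)) atTop (𝓝 0)) :
    ∃ C M : ℝ, 0 < C ∧ 0 < M ∧ ∀ w ∈ W, ∀ n : ℕ,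
      ‖(T ^ n) w‖ ≤ C * Real.exp (-M * n) * ‖w‖ := by
  let TW : W →L[ℂ] W := LinearMap.toContinuousLinearMap (T.restrict hTW)
  have hpow : ∀ (n : ℕ) (w : W), (((TW ^ n) w : W) : D) = (T ^ n) w := by
    intro n
    induction n with
    | zero => intro w; simp
    | succ n ih =>
      intro w
      rw [pow_succ, pow_succ]
      exact ih (TW w)
  let E : W →ₗ[ℂ] (ι → ℂ) := LinearMap.pi fun i => (ev i).comp W.subtype
  -- The evaluations separate points of a finite-dimensional space, so pointwise convergence is
  -- convergence in norm.
  have hE : Topology.IsClosedEmbedding E := LinearMap.isClosedEmbedding_of_injective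
    (LinearMap.ker_eq_bot'.2 fun w hw => Subtype.ext (hev w w.2 (congrFun hw)))
  have hW : ∀ w : W, Tendsto (fun n => (TW ^ n) w) atTop (𝓝 0) := by
    intro w
    rw [hE.isInducing.tendsto_nhds_iff, map_zero, tendsto_pi_nhds]
    intro i
    refine (hlim w w.2 i).congr fun n => ?_
    rw [← hpow]
    rfl
  obtain ⟨C, M, hC, hM, hCM⟩ := exists_norm_pow_le TW hW
  refine ⟨C, M, hC, hM, fun w hw n => ?_⟩
  rw [← hpow n ⟨w, hw⟩]
  exact (ContinuousLinearMap.le_opNorm _ _).trans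
    (mul_le_mul_of_nonneg_right (hCM n) (norm_nonneg _))

/-- Forgetting continuity is injective, so finite correlation, stated for algebraic functionals,
carries over to the normed dual, where operator norms are available. -/
theorem finiteDimensional_of_coe_mem {E : Type*} [NormedAddCommGroup E] [NormedSpace ℂ E]
    (W : Submodule ℂ (E →L[ℂ] ℂ)) (V : Submodule ℂ (E →ₗ[ℂ] ℂ)) [FiniteDimensional ℂ V]
    (h : ∀ w ∈ W, (w : E →ₗ[ℂ] ℂ) ∈ V) : FiniteDimensional ℂ W :=
  FiniteDimensional.of_injective (LinearMap.codRestrict V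
    ((ContinuousLinearMap.coeLM (R := ℂ) ℂ).comp W.subtype) fun w => h w w.2)
    fun _ _ hvw => Subtype.ext (ContinuousLinearMap.coe_injective (congrArg Subtype.val hvw))

/-- Symmetrization does not increase the distance to a selfadjoint element. -/
theorem norm_sub_symmetrization_le {A : Type*} [CStarAlgebra A] {Q : A} (hQ : IsSelfAdjoint Q)
    (D : A) : ‖Q - (2⁻¹ : ℂ) • (D + star D)‖ ≤ ‖Q - D‖ := by
  have e : Q - (2⁻¹ : ℂ) • (D + star D) = (2⁻¹ : ℂ) • ((Q - D) + star (Q - D)) := by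
    rw [star_sub, hQ.star_eq]
    have : Q = (2⁻¹ : ℂ) • (Q + Q) := by
      rw [← two_smul ℂ Q, smul_smul, inv_mul_cancel₀ two_ne_zero, one_smul]
    nth_rewrite 1 [this]
    rw [← smul_sub]
    congr 1
    abel
  have h3 := norm_add_le (Q - D) (star (Q - D))
  have h4 : ‖(2⁻¹ : ℂ)‖ = 2⁻¹ := by simp
  rw [norm_star] at h3
  rw [e, norm_smul, h4]
  linarith

/-! ### The transfer operator on correlation functionals -/

section TransferOperator

variable {A : Type*} [CStarAlgebra A] {L R : StarSubalgebra ℂ A} (φ : A →L[ℂ] ℂ)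

/-- The functional `x ↦ φ (Q x)` on `L`. -/
def corrFunctional (L : StarSubalgebra ℂ A) : A →ₗ[ℂ] (L →L[ℂ] ℂ) where
  toFun Q := (φ.comp (ContinuousLinearMap.mul ℂ A Q)).comp L.toSubalgebra.toSubmodule.subtypeL
  map_add' P Q := by ext; simp
  map_smul' c Q := by ext; simp

theorem corrFunctional_apply (Q : A) (x : L) : corrFunctional φ L Q x = φ (Q * x) := rfl

/-- Correlations which span a finite-dimensional space, on which a translation acts by a transfer
operator, decay exponentially as soon as they decay. -/
theorem exists_exponential_decay (hφ : ∀ x, ‖φ x‖ ≤ ‖x‖) (hone : φ 1 = 1)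
    (hfin : FiniteDimensional ℂ (R.toSubalgebra.toSubmodule.map (corrFunctional φ L)))
    (τ : A →ₗ[ℂ] A) (hτ1 : τ 1 = 1) (hτR : ∀ Q ∈ R, τ Q ∈ R) (hτφ : ∀ Q, φ (τ Q) = φ Q)
    (σ : L →L[ℂ] L) (hσ : ∀ (Q : A) (x : L), φ (Q * σ x) = φ (τ Q * x))
    (hmix : ∀ Q ∈ R, ∀ x ∈ L, Tendsto (fun n => φ ((τ ^ n) Q * x)) atTop (𝓝 (φ Q * φ x))) :
    ∃ C M : ℝ, 0 < C ∧ 0 < M ∧ ∀ Q ∈ R, ∀ x ∈ L, ∀ n : ℕ, 0 < n →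
      ‖φ ((τ ^ n) Q * x) - φ Q * φ x‖ ≤ C * Real.exp (-M * n) * ‖x‖ * ‖Q‖ := by
  set F := corrFunctional φ L with hF
  set W : Submodule ℂ (L →L[ℂ] ℂ) := R.toSubalgebra.toSubmodule.map F with hW
  -- The subtracted rank-one term removes the component along φ itself, which translation would
  -- preserve.
  let T : (L →L[ℂ] ℂ) →ₗ[ℂ] (L →L[ℂ] ℂ) :=
    { toFun := fun ψ => ψ.comp σ - ψ 1 • F 1
      map_add' := fun ψ χ => by ext; simp [add_mul]; ring
      map_smul' := fun c ψ => by ext; simp [mul_sub, mul_assoc] }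
  have hTF : ∀ Q, T (F Q) = F (τ Q - φ Q • 1) := fun Q => by
    ext x
    change φ (Q * σ x) - φ (Q * 1) * φ (1 * x) = φ ((τ Q - φ Q • 1) * x)
    rw [hσ, sub_mul, map_sub, smul_mul_assoc, map_smul, mul_one, smul_eq_mul]
  have hTW : ∀ w ∈ W, T w ∈ W := by
    rintro _ ⟨Q, hQ, rfl⟩
    rw [hTF]
    exact Submodule.mem_map_of_mem (sub_mem (hτR Q hQ) (R.smul_mem (one_mem R) _))
  have hτn : ∀ n Q, φ ((τ ^ n) Q) = φ Q := by
    intro n Q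
    induction n with
    | zero => simp
    | succ n ih => rw [pow_succ', Module.End.mul_apply, hτφ, ih]
  -- The exponent starts at 1: the zeroth power does not yet subtract φ(Q).
  have hpow : ∀ (n : ℕ) (Q : A), (T ^ (n + 1)) (F Q) = F ((τ ^ (n + 1)) Q - φ Q • 1) := by
    intro n Q
    induction n with
    | zero => rw [zero_add, pow_one, pow_one, hTF]
    | succ n ih =>
      rw [pow_succ', Module.End.mul_apply, ih, hTF, pow_succ' τ (n + 1)]
      simp [hτ1, hτn, hone]
  have happ : ∀ (n : ℕ) (Q : A) (x : L),
      (T ^ (n + 1)) (F Q) x = φ ((τ ^ (n + 1)) Q * x) - φ Q * φ x := by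
    intro n Q x
    rw [hpow, hF, corrFunctional_apply, sub_mul, map_sub, smul_mul_assoc, map_smul, one_mul,
      smul_eq_mul]
  obtain ⟨C, M, hC, hM, hCM⟩ := exists_norm_pow_le_of_weak W hfin T hTW
    (fun x : L => { toFun := fun ψ => ψ x, map_add' := fun _ _ => rfl, map_smul' := fun _ _ => rfl })
    (fun w _ h => ContinuousLinearMap.ext h) (by
      rintro _ ⟨Q, hQ, rfl⟩ x
      rw [← tendsto_add_atTop_iff_nat 1]
      have h := ((hmix Q hQ x x.2).comp (tendsto_add_atTop_nat 1)).sub_const (φ Q * φ x)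
      rw [sub_self] at h
      exact h.congr fun n => (happ n Q x).symm)
  refine ⟨C, M, hC, hM, fun Q hQ x hx n hn => ?_⟩
  obtain ⟨n, rfl⟩ := Nat.exists_eq_succ_of_ne_zero hn.ne'
  have hFQ : ‖F Q‖ ≤ ‖Q‖ := ContinuousLinearMap.opNorm_le_bound _ (norm_nonneg _) fun y =>
    (hφ _).trans (norm_mul_le _ _)
  have h := happ n Q ⟨x, hx⟩
  rw [← h]
  refine (ContinuousLinearMap.le_opNorm _ _).trans ?_
  have h2 := (hCM (F Q) (Submodule.mem_map_of_mem hQ) (n + 1)).trans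
    (mul_le_mul_of_nonneg_left hFQ (by positivity))
  refine (mul_le_mul_of_nonneg_right h2 (norm_nonneg _)).trans_eq ?_
  rw [mul_right_comm]
  rfl

end TransferOperator


/-! ### Exponential mixing on the spin chain -/

variable {φ : SpinChain d →ₗ[ℂ] ℂ}

/-- A state as a continuous linear functional. -/
def IsState.toCLM (h : IsState φ) : SpinChain d →L[ℂ] ℂ :=
  φ.mkContinuous 1 fun x => by simpa using h.norm_le x

/-- A translation to the left as an endomorphism of the algebra of the left half-line. -/
def shiftLeft : region (d := d) (Iic (-1)) →L[ℂ] region (d := d) (Iic (-1)) :=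
  LinearMap.mkContinuous
    { toFun := fun x => ⟨translate (-1) (x : SpinChain d), region_mono (by
          rintro _ ⟨i, hi, rfl⟩
          simp only [mem_Iic] at hi ⊢
          omega) (translate_mem (-1) x.2)⟩
      map_add' := fun x y => Subtype.ext (map_add (translate (d := d) (-1)) x.1 y.1)
      map_smul' := fun c x => Subtype.ext (map_smul (translate (d := d) (-1)) c x.1) }
    1 fun x => by
      rw [one_mul]
      exact norm_translate_le (-1) (x : SpinChain d)

theorem finiteDimensional_map_corrFunctional (h : IsState φ) (hfc : IsFinitelyCorrelated φ) :
    FiniteDimensional ℂ ((region (d := d) (Ici 0)).toSubalgebra.toSubmodule.map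
      (corrFunctional h.toCLM (region (d := d) (Iic (-1))))) := by
  have hfin := hfc (-1)
  refine finiteDimensional_of_coe_mem _ (LinearMap.range (corrMap φ (-1))) ?_
  rintro _ ⟨Q, hQ, rfl⟩
  have hQ' : Q ∈ region (d := d) (Ici (-1 + 1)) := by
    rw [neg_add_cancel]
    exact hQ
  exact ⟨⟨Q, hQ'⟩, rfl⟩

/-- The transfer-operator estimate for the two half-lines and the unit translation. Correlation
functionals put the right observable first while mixing puts it last; the two half-lines commute. -/
theorem isExponentiallyMixing (h : IsState φ) (hinv : IsTranslationInvariant φ)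
    (hfc : IsFinitelyCorrelated φ) (hmix : IsMixing φ) : IsExponentiallyMixing φ := by
  have hpow : ∀ (n : ℕ) (x : SpinChain d),
      (((translate (d := d) 1).toAlgHom.toLinearMap) ^ n) x = translate (n : ℤ) x := by
    intro n x
    induction n with
    | zero => simp [translate_zero]
    | succ n ih =>
      rw [pow_succ', Module.End.mul_apply, ih]
      change translate 1 (translate (n : ℤ) x) = _
      rw [translate_translate, add_comm]
      rfl
  have hcomm : ∀ (n : ℕ), ∀ Q ∈ region (d := d) (Ici 0), ∀ x ∈ region (d := d) (Iic (-1)),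
      translate (n : ℤ) Q * x = x * translate (n : ℤ) Q := fun n Q hQ x hx =>
    (region_commute (Set.disjoint_left.2 (by
      rintro _ ⟨i, hi, rfl⟩ hi'
      simp only [mem_Ici, mem_Iic] at hi hi'
      omega)) (translate_mem (n : ℤ) hQ) hx).eq
  obtain ⟨C, M, hC, hM, hCM⟩ := exists_exponential_decay (L := region (d := d) (Iic (-1)))
    (R := region (d := d) (Ici 0)) h.toCLM h.norm_le h.map_one
    (finiteDimensional_map_corrFunctional h hfc) (translate (d := d) 1).toAlgHom.toLinearMap
    (map_one (translate (d := d) 1))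
    (fun Q hQ => region_mono (by
      rintro _ ⟨i, hi, rfl⟩
      simp only [mem_Ici] at hi ⊢
      omega) (translate_mem 1 hQ))
    (fun Q => hinv 1 Q) shiftLeft
    (fun Q x => by
      change φ (Q * translate (-1) (x : SpinChain d)) = φ (translate 1 Q * x)
      rw [← hinv 1 (Q * translate (-1) (x : SpinChain d)), map_mul, translate_translate,
        add_neg_cancel, translate_zero])
    (fun Q hQ x hx => by
      have := hmix x Q
      rw [mul_comm (φ x)] at this
      refine this.congr fun n => ?_
      rw [hpow, hcomm n Q hQ x hx]
      rfl)
  refine ⟨C, M, hC, hM, fun x hx Q hQ n hn => ?_⟩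
  have := hCM Q hQ x hx n hn
  rw [hpow, hcomm n Q hQ x hx, mul_comm (h.toCLM Q)] at this
  exact this

/-- The mixing chain of an exponentially mixing state of the spin chain. -/
def mixingChain (h : IsState φ) (hinv : IsTranslationInvariant φ) {C M : ℝ} (hC : 0 < C)
    (hM : 0 < M) (hmix : ∀ Q₁ ∈ region (d := d) (Iic (-1)), ∀ Q₂ ∈ region (d := d) (Ici 0),
      ∀ n : ℕ, 0 < n → ‖φ (Q₁ * translate (n : ℤ) Q₂) - φ Q₁ * φ Q₂‖ ≤
        C * Real.exp (-M * n) * ‖Q₁‖ * ‖Q₂‖) : MixingChain (SpinChain d) where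
  region := region
  isClosed_region := isClosed_region
  region_mono := region_mono
  commute_of_disjoint := fun h _ _ hx hy => region_commute h hx hy
  shift := translate
  shift_mem := fun k _ hx => translate_mem k hx
  shift_zero := translate_zero
  shift_shift := translate_translate
  state := φ
  norm_state_le := h.norm_le
  state_one := h.map_one
  state_star_mul_self_nonneg := h.nonneg
  state_shift := hinv
  C := C
  M := M
  C_pos := hC
  M_pos := hM
  mixing := hmix

/-! ### Exponentially localized observables and the limit theorems -/

theorem locNorm_nonneg (n : ℕ) (Q : SpinChain d) : 0 ≤ locNorm n Q := by
  unfold locNorm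
  split_ifs
  · exact norm_nonneg _
  · exact Metric.infDist_nonneg

/-- Selfadjoint approximation of exponentially localized observables. -/
theorem IsExpLocalized.exists_approx {θ : ℝ} (h0 : 0 < θ) {Q : SpinChain d} (hsa : IsSelfAdjoint Q)
    (hQ : IsExpLocalized θ Q) :
    ∃ K : ℝ, ∀ m : ℕ, ∃ D ∈ region (d := d) (Icc (-(m : ℤ)) m),
      IsSelfAdjoint D ∧ ‖Q - D‖ ≤ K * θ ^ m := by
  set K := ∑' n : ℕ, locNorm n Q * (θ ^ n)⁻¹ with hK
  have hle : ∀ n, locNorm n Q ≤ K * θ ^ n := fun n => by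
    have hpos : 0 < θ ^ n := pow_pos h0 n
    rw [← div_le_iff₀ hpos, div_eq_mul_inv]
    exact hQ.le_tsum n fun k _ => mul_nonneg (locNorm_nonneg k Q) (inv_nonneg.2 (pow_pos h0 k).le)
  -- The distance to the local algebra is an infimum, so an actual approximant needs a constant
  -- strictly larger than K.
  refine ⟨K + 1, fun m => ?_⟩
  have hpos : 0 < θ ^ m := pow_pos h0 m
  have hlt : K * θ ^ m < (K + 1) * θ ^ m := by linarith
  -- For m = 0 the seminorm is the norm itself, so zero is the approximant.
  rcases Nat.eq_zero_or_pos m with rfl | hm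
  · refine ⟨0, zero_mem _, IsSelfAdjoint.zero _, ?_⟩
    rw [sub_zero]
    have := hle 0
    simp only [locNorm, if_true] at this
    exact this.trans hlt.le
  · have h1 := (hle m).trans_lt hlt
    simp only [locNorm, if_neg hm.ne'] at h1
    obtain ⟨D, hD, hdist⟩ := (Metric.infDist_lt_iff ⟨0, zero_mem (region (d := d) _)⟩).1 h1
    rw [dist_eq_norm] at hdist
    refine ⟨(2⁻¹ : ℂ) • (D + star D), (region (d := d) _).smul_mem (add_mem hD (star_mem hD)) _,
      ?_, ?_⟩
    · exact IsSelfAdjoint.smul (by simp [IsSelfAdjoint]) (IsSelfAdjoint.add_star_self D)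
    · exact (norm_sub_symmetrization_le hsa D).trans hdist.le

theorem jointCentralLimit_of_approx (h : IsState φ) (hinv : IsTranslationInvariant φ)
    (hexp : IsExponentiallyMixing φ) {θ : ℝ} (h0 : 0 < θ) (h1 : θ < 1) {r : ℕ}
    (Q : Fin r → SpinChain d) (hsa : ∀ k, IsSelfAdjoint (Q k))
    (hQ : ∀ k, ∃ K : ℝ, ∀ m : ℕ, ∃ D ∈ region (d := d) (Icc (-(m : ℤ)) m),
      IsSelfAdjoint D ∧ ‖Q k - D‖ ≤ K * θ ^ m) : JointCentralLimit φ Q := by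
  obtain ⟨C, M, hC, hM, hmix⟩ := hexp
  let S := mixingChain h hinv hC hM hmix
  have hfl : ∀ N (R : SpinChain d), S.fluctuation N R = fluct φ N R := fun N R => by
    simp only [MixingChain.fluctuation, MixingChain.sumOn, MixingChain.center, fluct, map_sub,
      map_smul, map_one]
    rfl
  have hj := S.joint_central_limit h0 h1 Q hsa hQ
  simp only [hfl] at hj
  exact hj

theorem fluct_real_smul (T : ℝ) (N : ℕ) (Q : SpinChain d) :
    fluct φ N (((T : ℝ) : ℂ) • Q) = ((T : ℝ) : ℂ) • fluct φ N Q := by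
  unfold fluct
  rw [smul_comm]
  congr 1
  rw [Finset.smul_sum]
  refine Finset.sum_congr rfl fun j _ => ?_
  rw [map_smul, map_smul, smul_sub, smul_smul, smul_eq_mul]

/-- The joint theorem for the single observable TQ, which has no commutator terms. Its variance is
T² times that of Q by uniqueness of limits, so one t, obtained at T = 1, serves for all T. -/
theorem centralLimit_of_approx (h : IsState φ) (hinv : IsTranslationInvariant φ)
    (hexp : IsExponentiallyMixing φ) {θ : ℝ} (h0 : 0 < θ) (h1 : θ < 1)
    (Q : SpinChain d) (hsa : IsSelfAdjoint Q)
    (hQ : ∃ K : ℝ, ∀ m : ℕ, ∃ D ∈ region (d := d) (Icc (-(m : ℤ)) m),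
      IsSelfAdjoint D ∧ ‖Q - D‖ ≤ K * θ ^ m) : CentralLimit φ Q := by
  have hreal : ∀ T : ℝ, IsSelfAdjoint ((T : ℝ) : ℂ) := fun T => Complex.conj_ofReal T
  have key : ∀ T : ℝ, JointCentralLimit φ fun _ : Fin 1 => ((T : ℝ) : ℂ) • Q := by
    intro T
    refine jointCentralLimit_of_approx h hinv hexp h0 h1 _ (fun _ => (hreal T).smul hsa) fun _ => ?_
    obtain ⟨K, hK⟩ := hQ
    refine ⟨|T| * K, fun m => ?_⟩
    obtain ⟨D, hD, hDsa, hQD⟩ := hK m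
    refine ⟨((T : ℝ) : ℂ) • D, (region (d := d) _).smul_mem hD _, (hreal T).smul hDsa, ?_⟩
    rw [← smul_sub, norm_smul, Complex.norm_real, Real.norm_eq_abs, mul_assoc]
    exact mul_le_mul_of_nonneg_left hQD (abs_nonneg T)
  obtain ⟨t, ht, hvar, -, -⟩ := key 1
  simp only [Complex.ofReal_one, one_smul, Finset.univ_unique, Finset.sum_singleton] at hvar
  refine ⟨t, ht, hvar, fun T => ?_⟩
  obtain ⟨t', -, hvar', -, hlim⟩ := key T
  simp only [Finset.univ_unique, Finset.sum_singleton, HasVariance, fluct_real_smul,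
    smul_mul_smul_comm, map_smul, smul_eq_mul] at hvar'
  have ht' : (t' : ℂ) = T * T * t := tendsto_nhds_unique hvar' (hvar.const_mul _)
  have hI : Finset.Ioi (0 : Fin 1) = ∅ := by decide
  simp only [Finset.univ_unique, Finset.sum_singleton, Fin.default_eq_zero, hI, Finset.sum_empty,
    mul_zero, Complex.exp_zero, mul_one, List.ofFn_succ, List.ofFn_zero, List.prod_singleton,
    fluct_real_smul, smul_smul, ht'] at hlim
  convert hlim using 3
  ring

end QSpin

end
theorem proposition4p2 (d : ℕ) [NeZero d] (φ : QSpin.SpinChain d →ₗ[ℂ] ℂ)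
    (hstate : QSpin.IsState φ) (hinv : QSpin.IsTranslationInvariant φ)
    (hfc : QSpin.IsFinitelyCorrelated φ) (hmix : QSpin.IsMixing φ) :
    QSpin.IsExponentiallyMixing φ ∧
    (∀ θ : ℝ, 0 < θ → θ < 1 → ∀ Q : QSpin.SpinChain d,
      IsSelfAdjoint Q → QSpin.IsExpLocalized θ Q → QSpin.CentralLimit φ Q) ∧
    (∀ θ : ℝ, 0 < θ → θ < 1 → ∀ (r : ℕ) (Q : Fin r → QSpin.SpinChain d),
      (∀ k, IsSelfAdjoint (Q k)) → (∀ k, QSpin.IsExpLocalized θ (Q k)) →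
        QSpin.JointCentralLimit φ Q) := by
  have hexp := QSpin.isExponentiallyMixing hstate hinv hfc hmix
  exact ⟨hexp, fun θ h0 h1 Q hsa hQ =>
    QSpin.centralLimit_of_approx hstate hinv hexp h0 h1 Q hsa (hQ.exists_approx h0 hsa),
    fun θ h0 h1 r Q hsa hQ => QSpin.jointCentralLimit_of_approx hstate hinv hexp h0 h1 Q hsa
      fun k => (hQ k).exists_approx h0 (hsa k)⟩
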